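/- **Setting.** Let $\mathbb K=\mathbb R$ or $\mathbb C$. A *Hilbert complex* $(W,\mathrm d)$ consists of Hilbert spaces $W^k$ ($k\in\mathbb Z$) and closed densely defined linear maps $\mathrm d^k\colon V^k\subset W^k\to W^{k+1}$ with $\mathrm d^kV^k\subset V^{k+1}$ and $\mathrm d^{k+1}\mathrm d^{k}=0$; it is *closed* if every $\mathfrak B^{k+1}=\mathrm d^kV^k$ is closed in $W^{k+1}$. The spaces $V^k$ form its domain complex. Put $\mathfrak Z^k=\ker\mathrm d^k$, $\mathfrak H^k=\mathfrak Z^k\cap(\mathfrak B^{k})^{\perp}$, and let $V_k^*$ be the domain of the adjoint $\mathrm d_k^*$ of $\mathrm d^{k-1}$. The complex has the *compactness property* if for every $k$ the inclusion $V^k\cap V^*_k\hookrightarrow W^k$ is compact, where $V^k\cap V_k^*$ has the norm $(\|u\|^2+\|\mathrm d u\|^2+\|\mathrm d^*u\|^2)^{1/2}$. A *morphism* of Hilbert complexes is a sequence of bounded maps $f^k\colon W^k\to W'^k$ with $f^kV^k\subset V'^k$ and $\mathrm d'^kf^k=f^{k+1}\mathrm d^k$. The *mixed problem* in degree $k$ with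 right-hand side $f\in W^k$ is to find $(\sigma,u,p)\in V^{k-1}\times V^k\times\mathfrak H^k$ with $$\langle\sigma,\tau\rangle-\langle u,\mathrm d\tau\rangle=0,\qquad \langle\mathrm d\sigma,v\rangle+\langle\mathrm du,\mathrm dv\rangle+\langle p,v\rangle=\langle f,v\rangle,\qquad \langle u,q\rangle=0$$ for all $\tau\in V^{k-1}$, $v\in V^k$, $q\in\mathfrak H^k$. Its solution operator is $K\colon W^k\to W^k$, $Kf=u$. The *eigenvalue problem* is the same system with $f=\lambda u$; an eigenvector is a nonzero $u$ arising in this way. **Theorem.** Let $(W,\mathrm d)$ be a closed Hilbert complex with the compactness property. Let $(W_h,\mathrm d_h)$ be a family of closed Hilbert complexes, with a parameter $h\to0$ (or, more generally, indexed by any set, the limits being taken along any filter on it), and let $i_h\colon W_h\to W$ and $\pi_h\colon W\to W_h$ be morphisms with $\pi_h^ki_h^k=\mathrm{id}$ for all $k$ and with $\|i_h^k\|$ and $\|\pi_h^k\|$ bounded uniformly in $h$ for each $k$. Assume also that for each $k$ $$\inf_{v\in V_h^k}\|u-i_h^kv\|\to0\ \text{ for every }u\in V^k,\qquad \|I-J_h^k\|\to0,\quad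 J_h^k=(i_h^k)^*i_h^k .$$ Then for every $k$ the discrete eigenvalue problems in degree $k$, i.e. those of the complexes $(W_h,\mathrm d_h)$ posed in $V_h^{k-1}\times V_h^k\times\mathfrak H_h^k$ with the inner products of $W_h$, converge to the eigenvalue problem of $(W,\mathrm d)$. This means the following. 1. The solution operators $K$ of $(W,\mathrm d)$ and $K_h$ of $(W_h,\mathrm d_h)$ exist, are uniquely determined and bounded, and $\|K-i_hK_hP_h\|\to0$ in $\mathcal L(W^k,W^k)$, where $P_h=\pi_hP_{i_hW_h}$ and $P_{i_hW_h}$ is the orthogonal projection of $W^k$ onto $i_hW_h^k$. 2. The eigenvalues of the exact problem, repeated according to multiplicity, can be listed in a nondecreasing finite or infinite sequence $(\lambda_n)_{1\le n\le N}$, $N\in\{0,1,\dots,\infty\}$, of real numbers with orthonormal eigenvectors $(u_n)$ such that each eigenspace is spanned by the $u_n$ belonging to it; and for each $h$ likewise $(\lambda_{n,h},u_{n,h})_{1\le n\le N_h}$ for the discrete problem. 3. For any choice of these lists: if $n\le N$, then $n\le N_h$ eventually, and $\lambda_{n,h}\to\lambda_n$; if $N<n<\infty$, then for every $M\in\mathbb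 R$ eventually either $N_h<n$ or $\lambda_{n,h}>M$; and for every finite $m\le N$ such that $m=0$, $m=N$ or $\lambda_m<\lambda_{m+1}$, $$\operatorname{gap}\bigl(\operatorname{span}\{u_1,\dots,u_m\},\; i_h\operatorname{span}\{u_{1,h},\dots,u_{m,h}\}\bigr)\to0,$$ where $\operatorname{gap}(E,F)=\max\bigl(\sup_{u\in E,\|u\|=1}\inf_{v\in F}\|u-v\|,\ \sup_{v\in F,\|v\|=1}\inf_{u\in E}\|u-v\|\bigr)$. -/

import Mathlib

open Filter Topology

noncomputable section

/-- A Hilbert complex on the Hilbert spaces `W k`, `k ∈ ℤ`: closed, densely defined, possibly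
unbounded operators `d k` from `W k` to `W (k + 1)`, with `d ∘ d = 0`.  The space `V k` of the
domain complex is `(d k).domain`. -/
structure HilbertComplex (𝕜 : Type*) [RCLike 𝕜] (W : ℤ → Type*)
    [∀ k, NormedAddCommGroup (W k)] [∀ k, InnerProductSpace 𝕜 (W k)]
    [∀ k, CompleteSpace (W k)] where
  d : ∀ k : ℤ, W k →ₗ.[𝕜] W (k + 1)
  dense_domain : ∀ k, Dense ((d k).domain : Set (W k))
  isClosed_d : ∀ k, (d k).IsClosed
  d_mem : ∀ k (u : (d k).domain), d k u ∈ (d (k + 1)).domain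
  d_d : ∀ k (u : (d k).domain), d (k + 1) ⟨d k u, d_mem k u⟩ = 0

namespace HilbertComplex

variable {𝕜 : Type*} [RCLike 𝕜]
  {W : ℤ → Type*} [∀ k, NormedAddCommGroup (W k)] [∀ k, InnerProductSpace 𝕜 (W k)]
  [∀ k, CompleteSpace (W k)]
  {W' : ℤ → Type*} [∀ k, NormedAddCommGroup (W' k)] [∀ k, InnerProductSpace 𝕜 (W' k)]
  [∀ k, CompleteSpace (W' k)]

/-- The `k`-cocycles: the kernel of `d k`, as a subspace of `W k`. -/
def cocycles (C : HilbertComplex 𝕜 W) (k : ℤ) : Submodule 𝕜 (W k) :=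
  (LinearMap.ker (C.d k).toFun).map (C.d k).domain.subtype

/-- The `(k + 1)`-coboundaries: the image of `d k`. -/
def coboundaries (C : HilbertComplex 𝕜 W) (k : ℤ) : Submodule 𝕜 (W (k + 1)) :=
  LinearMap.range (C.d k).toFun

/-- The harmonic space in degree `k + 1`: cocycles orthogonal to all coboundaries. -/
def harmonic (C : HilbertComplex 𝕜 W) (k : ℤ) : Submodule 𝕜 (W (k + 1)) :=
  C.cocycles (k + 1) ⊓ (C.coboundaries k)ᗮ

/-- A Hilbert complex is closed if the image of every differential is closed. -/
def IsClosedComplex (C : HilbertComplex 𝕜 W) : Prop :=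
  ∀ k, IsClosed (C.coboundaries k : Set (W (k + 1)))

/-- The compactness property: in every degree the inclusion of `V ∩ V*` into `W` is compact, where
`V*` is the domain of the adjoint of the incoming differential and `V ∩ V*` carries the norm
`(‖u‖² + ‖d u‖² + ‖d* u‖²)^(1/2)`; that is, the unit ball of `V ∩ V*` is relatively compact. -/
def CompactnessProperty (C : HilbertComplex 𝕜 W) : Prop :=
  ∀ k : ℤ, IsCompact (closure {u : W (k + 1) |
    ∃ (hu : u ∈ (C.d (k + 1)).domain) (hu' : u ∈ (C.d k).adjoint.domain),
      ‖u‖ ^ 2 + ‖C.d (k + 1) ⟨u, hu⟩‖ ^ 2 + ‖(C.d k).adjoint ⟨u, hu'⟩‖ ^ 2 ≤ 1})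

/-- A morphism of Hilbert complexes: bounded maps of the Hilbert spaces that preserve the domains
and commute with the differentials. -/
structure Morphism (C : HilbertComplex 𝕜 W) (C' : HilbertComplex 𝕜 W') where
  toMap : ∀ k : ℤ, W k →L[𝕜] W' k
  map_mem : ∀ k (u : (C.d k).domain), toMap k u ∈ (C'.d k).domain
  comm : ∀ k (u : (C.d k).domain), C'.d k ⟨toMap k u, map_mem k u⟩ = toMap (k + 1) (C.d k u)

/-- `(σ, u, p)` solves the mixed variational problem for the Hodge Laplacian in degree `k + 1`
with right-hand side `f`. -/
def IsMixedSolution (C : HilbertComplex 𝕜 W) (k : ℤ) (f : W (k + 1))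
    (σ : (C.d k).domain) (u : (C.d (k + 1)).domain) (p : C.harmonic k) : Prop :=
  (∀ τ : (C.d k).domain,
    inner 𝕜 (σ : W k) (τ : W k) - inner 𝕜 (u : W (k + 1)) (C.d k τ) = 0) ∧
  (∀ v : (C.d (k + 1)).domain,
    inner 𝕜 (C.d k σ) (v : W (k + 1)) + inner 𝕜 (C.d (k + 1) u) (C.d (k + 1) v)
      + inner 𝕜 (p : W (k + 1)) (v : W (k + 1)) = inner 𝕜 f (v : W (k + 1))) ∧
  (∀ q : C.harmonic k, inner 𝕜 (u : W (k + 1)) (q : W (k + 1)) = 0)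

/-- `K` is the solution operator `f ↦ u` of the mixed problem in degree `k + 1`. The equivalence
says that a solution exists for every `f`, and that its component `u` is unique. -/
def IsSolutionOperator (C : HilbertComplex 𝕜 W) (k : ℤ) (K : W (k + 1) →L[𝕜] W (k + 1)) : Prop :=
  ∀ f u : W (k + 1), K f = u ↔
    ∃ (σ : (C.d k).domain) (hu : u ∈ (C.d (k + 1)).domain) (p : C.harmonic k),
      C.IsMixedSolution k f σ ⟨u, hu⟩ p

/-- `u` is the middle component of a solution `(σ, u, p)` of the Hodge-Laplace eigenvalue problem
in degree `k + 1` with parameter `t`. (If `u = 0`, then `σ = 0` and `p = 0` too.) -/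
def SolvesEigenproblem (C : HilbertComplex 𝕜 W) (k : ℤ) (t : 𝕜) (u : W (k + 1)) : Prop :=
  ∃ (σ : (C.d k).domain) (hu : u ∈ (C.d (k + 1)).domain) (p : C.harmonic k),
    C.IsMixedSolution k (t • u) σ ⟨u, hu⟩ p

/-- `lam 0 ≤ lam 1 ≤ ⋯` (indices `n < N`, where `N` is finite or infinite) are all the eigenvalues
of the Hodge-Laplace eigenvalue problem in degree `k + 1`, repeated according to multiplicity, and
the `u n` with `n < N` are corresponding orthonormal eigenvectors spanning all eigenspaces. -/
structure IsEigensystem (C : HilbertComplex 𝕜 W) (k : ℤ) (N : ℕ∞) (lam : ℕ → ℝ)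
    (u : ℕ → W (k + 1)) : Prop where
  orthonormal : Orthonormal 𝕜 (fun n : {n : ℕ // (n : ℕ∞) < N} => u n)
  monotone : ∀ m n : ℕ, m ≤ n → (n : ℕ∞) < N → lam m ≤ lam n
  solves : ∀ n : ℕ, (n : ℕ∞) < N → C.SolvesEigenproblem k (lam n : 𝕜) (u n)
  complete : ∀ (t : 𝕜) (v : W (k + 1)), C.SolvesEigenproblem k t v →
    v ∈ Submodule.span 𝕜 {w | ∃ n : ℕ, (n : ℕ∞) < N ∧ (lam n : 𝕜) = t ∧ u n = w}

end HilbertComplex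

/-- The gap between two subspaces: the maximum of the suprema, over the unit vectors of either
subspace, of the distance to the other subspace. (The suprema are at most `1`, and `0` for the zero
subspace.) -/
def subspaceGap {𝕜 E : Type*} [RCLike 𝕜] [NormedAddCommGroup E] [InnerProductSpace 𝕜 E]
    (A B : Submodule 𝕜 E) : ℝ :=
  max (⨆ a : {a : E // a ∈ A ∧ ‖a‖ = 1}, Metric.infDist (a : E) (B : Set E))
    (⨆ b : {b : E // b ∈ B ∧ ‖b‖ = 1}, Metric.infDist (b : E) (A : Set E))

/-- `π ∘ P`, where `P` is the orthogonal projection onto the range of `i`. The closure only serves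
to have a closed subspace by construction: if `π ∘ i = id`, then the range of `i` is closed, and
`i ∘ (π ∘ P) = P`. -/
def pulledBackProjection {𝕜 E F : Type*} [RCLike 𝕜]
    [NormedAddCommGroup E] [InnerProductSpace 𝕜 E] [CompleteSpace E]
    [NormedAddCommGroup F] [InnerProductSpace 𝕜 F]
    (i : F →L[𝕜] E) (π : E →L[𝕜] F) : E →L[𝕜] F :=
  π ∘L (LinearMap.range (i : F →ₗ[𝕜] E)).topologicalClosure.starProjection

/-- Convergence of eigenvalue problems, for an exact problem on `E` with eigenvalues `lam n` and
eigenvectors `u n` (`n < N`), and problems on spaces `F h` with eigenvalues `lamh h n` and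
eigenvectors `uh h n` (`n < Nh h`), embedded by `i h : F h → E`.

* For each `n < N`, the `n`-th discrete eigenvalue eventually exists and tends to the exact one.
* If there are only finitely many exact eigenvalues, any further discrete ones tend to infinity.
* If `m` is the number of eigenvalues, with multiplicity, in an initial segment of the distinct
  exact eigenvalues, then the gap between the span of the first `m` exact eigenvectors and the
  image of the span of the first `m` discrete ones tends to zero. -/
structure EigenproblemsConverge {𝕜 ι E : Type*} [RCLike 𝕜] (l : Filter ι)
    [NormedAddCommGroup E] [InnerProductSpace 𝕜 E]
    {F : ι → Type*} [∀ h, NormedAddCommGroup (F h)] [∀ h, InnerProductSpace 𝕜 (F h)]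
    (i : ∀ h, F h →L[𝕜] E)
    (N : ℕ∞) (lam : ℕ → ℝ) (u : ℕ → E)
    (Nh : ι → ℕ∞) (lamh : ι → ℕ → ℝ) (uh : ∀ h, ℕ → F h) : Prop where
  exists_discrete : ∀ n : ℕ, (n : ℕ∞) < N → ∀ᶠ h in l, (n : ℕ∞) < Nh h
  tendsto_eigenvalue : ∀ n : ℕ, (n : ℕ∞) < N → Tendsto (fun h => lamh h n) l (𝓝 (lam n))
  no_spurious : ∀ n : ℕ, N ≤ (n : ℕ∞) → ∀ M : ℝ, ∀ᶠ h in l, (n : ℕ∞) < Nh h → M < lamh h n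
  tendsto_gap : ∀ m : ℕ, (m : ℕ∞) ≤ N →
    (∀ a b : ℕ, a < m → m ≤ b → (b : ℕ∞) < N → lam a < lam b) →
    Tendsto (fun h => subspaceGap
      (Submodule.span 𝕜 {w | ∃ n < m, u n = w})
      ((Submodule.span 𝕜 {w | ∃ n < m, uh h n = w}).map (i h : F h →ₗ[𝕜] E))) l (𝓝 0)

end

/-! Everything rests on a factorization of the solution operator. Let T be the partial inverse of `d
k` (zero on 𝔅^⊥, with values in ℨ^⊥) and S that of `d (k + 1)`. Then K = T*T + SS*. This is
positive, and it is compact because the compactness property makes T and S compact. The eigenvalue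
problem becomes t K u = u, so its eigenvalues are the reciprocals of the nonzero eigenvalues of K.

The partial inverse for a retract is T_h = P_{ℨ_h^⊥} π_h T i_h P_{𝔅_h} (`eq_of_retraction`):
transport T and remove the cocycle part. This gives uniform bounds for T_h, and its compactness
without assuming it of the discrete complexes. Moreover i_h T_h i_h* = X_h T (I + Y_h) with X_h =
i_h P_{ℨ_h^⊥} π_h and Y_h = i_h P_{𝔅_h} i_h* - I. Since J_h → I, the maps i_h* and π_h agree
asymptotically at each point. As i_h* maps ℨ^⊥ into ℨ_h^⊥ and π_h maps 𝔅 into 𝔅_h, it follows that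
X_h → I pointwise on ℨ^⊥, which contains the range of T, and Y_h → 0 pointwise on 𝔅, which contains
the range of T*. Compactness of T turns this into norm convergence (`tendsto_partialInverse`).
Multiplying the factors, where J_h → I absorbs the products i_h* i_h, gives i_h K_h i_h* → K in
norm, and P_h differs from i_h* by O(‖I - J_h‖).

The rest is spectral perturbation theory for positive compact operators. Min-max along the almost
isometric maps i_h and i_h* compares the eigenvalues (`le_mul_add_norm`); a residual estimate,
divided by the distance to the next eigenvalue, compares the eigenspaces
(`mul_norm_starProjection_le`). -/

open ContinuousLinearMap (adjoint)

/-! ### Spectral decomposition of positive compact operators. -/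

section SpectralSystem

variable {𝕜 E : Type*} [RCLike 𝕜] [NormedAddCommGroup E] [InnerProductSpace 𝕜 E]

/-- The span of those `u n` with `n < m` and `n < N`. -/
def initialSpan (𝕜 : Type*) {E : Type*} [RCLike 𝕜] [NormedAddCommGroup E] [InnerProductSpace 𝕜 E]
    (N : ℕ∞) (u : ℕ → E) (m : ℕ) : Submodule 𝕜 E :=
  Submodule.span 𝕜 {w | ∃ n < m, (n : ℕ∞) < N ∧ u n = w}

/-- The nonzero eigenvalues of a positive compact operator in nonincreasing order, repeated
according to multiplicity and continued by zero, with orthonormal eigenvectors. -/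
structure IsSpectralSystem (K : E →L[𝕜] E) (N : ℕ∞) (μ : ℕ → ℝ) (u : ℕ → E) : Prop where
  orthonormal : Orthonormal 𝕜 (fun n : {n : ℕ // (n : ℕ∞) < N} => u n)
  antitone : Antitone μ
  pos : ∀ n : ℕ, (n : ℕ∞) < N → 0 < μ n
  eq_zero : ∀ n : ℕ, N ≤ (n : ℕ∞) → μ n = 0
  apply_eq : ∀ n : ℕ, (n : ℕ∞) < N → K (u n) = (μ n : 𝕜) • u n
  mem_span : ∀ (t : ℝ) (v : E), 0 < t → K v = (t : 𝕜) • v →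
    v ∈ Submodule.span 𝕜 {w | ∃ n : ℕ, (n : ℕ∞) < N ∧ μ n = t ∧ u n = w}

instance initialSpan_finiteDimensional (N : ℕ∞) (u : ℕ → E) (m : ℕ) :
    FiniteDimensional 𝕜 (initialSpan 𝕜 N u m) := by
  refine FiniteDimensional.span_of_finite 𝕜 (((Set.finite_lt_nat m).image u).subset ?_)
  rintro _ ⟨n, hn, -, rfl⟩
  exact ⟨n, hn, rfl⟩

theorem re_inner_apply_le_norm_mul (K : E →L[𝕜] E) (x : E) :
    RCLike.re (inner 𝕜 (K x) x) ≤ ‖K‖ * ‖x‖ ^ 2 :=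
  calc RCLike.re (inner 𝕜 (K x) x) ≤ ‖K x‖ * ‖x‖ := re_inner_le_norm _ _
    _ ≤ ‖K‖ * ‖x‖ * ‖x‖ := by gcongr; exact K.le_opNorm x
    _ = _ := by ring

theorem apply_mem_orthogonal {K : E →L[𝕜] E} (hK : K.IsPositive) {S : Submodule 𝕜 E}
    (hS : ∀ x ∈ S, K x ∈ S) {x : E} (hx : x ∈ Sᗮ) : K x ∈ Sᗮ := by
  intro y hy
  rw [← hK.inner_left_eq_inner_right]
  exact hx _ (hS y hy)

/-- Eigenvectors of a positive operator for different real eigenvalues are orthogonal. -/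
theorem inner_eq_zero_of_eigenvalue_ne {K : E →L[𝕜] E} (hpos : K.IsPositive) {s t : ℝ} {v w : E}
    (hv : K v = (s : 𝕜) • v) (hw : K w = (t : 𝕜) • w) (hst : s ≠ t) : inner 𝕜 v w = 0 := by
  have h := hpos.inner_left_eq_inner_right v w
  rw [hv, hw, inner_smul_left, inner_smul_right, RCLike.conj_ofReal] at h
  have h1 : ((s : 𝕜) - (t : 𝕜)) * inner 𝕜 v w = 0 := by rw [sub_mul, h, sub_self]
  rcases mul_eq_zero.1 h1 with h2 | h2
  · exact absurd (by exact_mod_cast sub_eq_zero.1 h2) hst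
  · exact h2

/-- The eigenvalues belonging to an orthonormal sequence of eigenvectors of a compact operator are
not bounded away from zero. -/
theorem not_forall_le_of_orthonormal_eigenvectors {K : E →L[𝕜] E} (hK : IsCompactOperator K)
    {u : ℕ → E} (hu : Orthonormal 𝕜 u) {μ : ℕ → ℝ} (h : ∀ n, K (u n) = (μ n : 𝕜) • u n)
    {t : ℝ} (ht : 0 < t) : ¬ ∀ n, t ≤ μ n := by
  intro hle
  obtain ⟨Q, hQ, hsub⟩ := hK.image_closedBall_subset_compact t⁻¹
  have hmem : ∀ n, u n ∈ Q := fun n => by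
    have hμ : 0 < μ n := ht.trans_le (hle n)
    refine hsub ⟨(((μ n)⁻¹ : ℝ) : 𝕜) • u n, ?_, ?_⟩
    · rw [mem_closedBall_zero_iff, norm_smul, hu.1 n, mul_one, RCLike.norm_ofReal,
        abs_of_pos (inv_pos.2 hμ)]
      exact inv_anti₀ ht (hle n)
    · change K ((((μ n)⁻¹ : ℝ) : 𝕜) • u n) = u n
      rw [map_smul, h n, smul_smul, ← RCLike.ofReal_mul, inv_mul_cancel₀ hμ.ne',
        RCLike.ofReal_one, one_smul]
  obtain ⟨a, -, φ, hφ, hlim⟩ := hQ.tendsto_subseq hmem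
  obtain ⟨M, hM⟩ := Metric.cauchySeq_iff'.1 hlim.cauchySeq 1 one_pos
  have h1 := hM (M + 1) (Nat.le_succ M)
  have hne : φ (M + 1) ≠ φ M := (hφ (Nat.lt_succ_self M)).ne'
  have h2 : ‖u (φ (M + 1)) - u (φ M)‖ ^ 2 = 2 := by
    rw [norm_sub_sq (𝕜 := 𝕜), hu.2 hne, hu.1, hu.1]
    norm_num
  rw [dist_eq_norm] at h1
  simp only [Function.comp_apply] at h1
  nlinarith [norm_nonneg (u (φ (M + 1)) - u (φ M))]

variable [CompleteSpace E]

/-- The compression of an operator to the orthogonal complement of a subspace. -/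
noncomputable def compression (K : E →L[𝕜] E) (S : Submodule 𝕜 E) : E →L[𝕜] E :=
  Sᗮ.starProjection ∘L K ∘L Sᗮ.starProjection

theorem IsCompactOperator.compression {K : E →L[𝕜] E} (hK : IsCompactOperator K)
    (S : Submodule 𝕜 E) : IsCompactOperator (compression K S) :=
  (hK.comp_clm Sᗮ.starProjection).clm_comp Sᗮ.starProjection

theorem ContinuousLinearMap.IsPositive.compression {K : E →L[𝕜] E} (hK : K.IsPositive)
    (S : Submodule 𝕜 E) : (compression K S).IsPositive :=
  hK.conj_starProjection _

/-- Compressing to the smaller complement amounts to compressing the compression again, and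
projections have norm at most one. This is what makes the successively selected eigenvalues
nonincreasing. -/
theorem norm_compression_le_of_le (K : E →L[𝕜] E) {S S' : Submodule 𝕜 E} (h : S ≤ S') :
    ‖compression K S'‖ ≤ ‖compression K S‖ := by
  have h' : S'ᗮ ≤ Sᗮ := Submodule.orthogonal_le h
  have e : compression K S'
      = S'ᗮ.starProjection ∘L compression K S ∘L S'ᗮ.starProjection := by
    ext x
    simp only [compression, ContinuousLinearMap.comp_apply]
    have e1 : Sᗮ.starProjection (S'ᗮ.starProjection x) = S'ᗮ.starProjection x :=
      Submodule.starProjection_eq_self_iff.2 (h' (Submodule.starProjection_apply_mem _ _))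
    have e2 : ∀ y, S'ᗮ.starProjection (Sᗮ.starProjection y) = S'ᗮ.starProjection y := fun y =>
      congrArg (fun f : E →L[𝕜] E => f y) (Submodule.starProjection_comp_starProjection_of_le h')
    rw [e1, e2]
  rw [e]
  have n1 := S'ᗮ.starProjection_norm_le
  calc _ ≤ ‖S'ᗮ.starProjection‖ * (‖compression K S‖ * ‖S'ᗮ.starProjection‖) :=
        (ContinuousLinearMap.opNorm_comp_le _ _).trans
          (mul_le_mul_of_nonneg_left (ContinuousLinearMap.opNorm_comp_le _ _) (norm_nonneg _))
    _ ≤ 1 * (‖compression K S‖ * 1) := by gcongr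
    _ = _ := by ring

/-- The norm of a nonzero positive compact operator is an eigenvalue. -/
theorem exists_norm_eigenvector {K : E →L[𝕜] E} (hK : IsCompactOperator K) (hpos : K.IsPositive)
    (h0 : K ≠ 0) : ∃ w : E, ‖w‖ = 1 ∧ K w = (‖K‖ : 𝕜) • w := by
  have : Nontrivial E := by
    by_contra h
    rw [not_nontrivial_iff_subsingleton] at h
    exact h0 (by ext x; exact Subsingleton.elim _ _)
  -- Were ‖K‖ in the resolvent set, the Rayleigh quotient would stay below ‖K‖ by a fixed amount,
  -- although its supremum is ‖K‖. By compactness, a nonzero point of the spectrum is an eigenvalue.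
  have hmem : algebraMap ℝ 𝕜 ‖K‖ ∈ spectrum 𝕜 K := by
    rw [spectrum, Set.mem_compl_iff]
    intro h
    obtain ⟨c, hc0, hc⟩ := K.rayleighQuotient_le_of_norm_mem_resolventSet h
    have : ∀ x, |K.rayleighQuotient x| ≤ ‖K‖ - c := fun x => by
      rw [abs_of_nonneg]
      · exact hc x
      · exact div_nonneg (hpos.2 x) (by positivity)
    have := ciSup_le this
    rw [← K.norm_eq_iSup_rayleighQuotient hpos.isSymmetric] at this
    linarith
  have hne : algebraMap ℝ 𝕜 ‖K‖ ≠ 0 := by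
    simpa using h0
  obtain ⟨v, hv⟩ := ((hK.hasEigenvalue_iff_mem_spectrum hne).2 hmem).exists_hasEigenvector
  have hv0 : (‖v‖ : 𝕜) ≠ 0 := by simpa using hv.2
  have hv1 : K v = (‖K‖ : 𝕜) • v := hv.apply_eq_smul
  refine ⟨(‖v‖ : 𝕜)⁻¹ • v, ?_, ?_⟩
  · rw [norm_smul, norm_inv, RCLike.norm_ofReal, abs_norm, inv_mul_cancel₀]
    simpa using hv.2
  · rw [map_smul, hv1, smul_comm]

theorem compression_apply_of_mem {K : E →L[𝕜] E} (hK : K.IsPositive) {S : Submodule 𝕜 E}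
    (hS : ∀ x ∈ S, K x ∈ S) {x : E} (hx : x ∈ Sᗮ) : compression K S x = K x := by
  simp only [compression, ContinuousLinearMap.comp_apply]
  rw [Submodule.starProjection_eq_self_iff.2 hx,
    Submodule.starProjection_eq_self_iff.2 (apply_mem_orthogonal hK hS hx)]

/-- On the orthogonal complement of an invariant subspace, a nonzero compression of a positive
compact operator attains its norm at an eigenvector of the operator. -/
theorem exists_eigenvector_compression {K : E →L[𝕜] E} (hK : IsCompactOperator K)
    (hpos : K.IsPositive) {S : Submodule 𝕜 E} (hS : ∀ x ∈ S, K x ∈ S) (h0 : compression K S ≠ 0) :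
    ∃ w ∈ Sᗮ, ‖w‖ = 1 ∧ K w = (‖compression K S‖ : 𝕜) • w := by
  obtain ⟨w, hw1, hw⟩ := exists_norm_eigenvector (hK.compression S) (hpos.compression S) h0
  have hne : (‖compression K S‖ : 𝕜) ≠ 0 := by simpa using h0
  have hmem : w ∈ Sᗮ := by
    have : (‖compression K S‖ : 𝕜) • w ∈ Sᗮ := by
      rw [← hw]
      exact Submodule.starProjection_apply_mem _ _
    exact (Submodule.smul_mem_iff _ hne).1 this
  exact ⟨w, hmem, hw1, by rw [← hw, compression_apply_of_mem hpos hS hmem]⟩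

/-- Successive maximization of the Rayleigh quotient of a positive compact operator. -/
theorem exists_isSpectralSystem {K : E →L[𝕜] E} (hK : IsCompactOperator K) (hpos : K.IsPositive) :
    ∃ N μ u, IsSpectralSystem (𝕜 := 𝕜) K N μ u := by
  classical
  -- The next eigenvector is chosen as a total function of the subspace, with default value 0, so
  -- that the selection can be iterated.
  have hex : ∀ S : Submodule 𝕜 E, ∃ w : E, (∀ x ∈ S, K x ∈ S) → compression K S ≠ 0 →
      w ∈ Sᗮ ∧ ‖w‖ = 1 ∧ K w = (‖compression K S‖ : 𝕜) • w := fun S => by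
    by_cases h : (∀ x ∈ S, K x ∈ S) ∧ compression K S ≠ 0
    · obtain ⟨w, hw⟩ := exists_eigenvector_compression hK hpos h.1 h.2
      exact ⟨w, fun _ _ => hw⟩
    · exact ⟨0, fun h1 h2 => absurd ⟨h1, h2⟩ h⟩
  choose top htop using hex
  -- The span of the eigenvectors selected so far; it stays constant once the remaining compression
  -- vanishes.
  let S : ℕ → Submodule 𝕜 E := fun n =>
    Nat.rec ⊥ (fun _ T => if compression K T = 0 then T else T ⊔ Submodule.span 𝕜 {top T}) n
  have S_succ : ∀ n, S (n + 1) =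
      if compression K (S n) = 0 then S n else S n ⊔ Submodule.span 𝕜 {top (S n)} := fun n => rfl
  have S_mono : Monotone S := monotone_nat_of_le_succ fun n => by
    rw [S_succ]
    split_ifs
    · exact le_rfl
    · exact le_sup_left
  have S_inv : ∀ n, ∀ x ∈ S n, K x ∈ S n := fun n => by
    induction n with
    | zero =>
      intro x hx
      rw [(Submodule.mem_bot 𝕜).1 hx, map_zero]
      exact zero_mem _
    | succ n ih =>
      rw [S_succ]
      split_ifs with h0
      · exact ih
      · have hle : S n ⊔ Submodule.span 𝕜 {top (S n)}
            ≤ (S n ⊔ Submodule.span 𝕜 {top (S n)}).comap (K : E →ₗ[𝕜] E) := by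
          refine sup_le (fun x hx => Submodule.mem_sup_left (ih x hx)) ?_
          rw [Submodule.span_singleton_le_iff_mem, Submodule.mem_comap]
          change K (top (S n)) ∈ _
          rw [(htop (S n) ih h0).2.2]
          exact Submodule.smul_mem _ _
            (Submodule.mem_sup_right (Submodule.mem_span_singleton_self _))
        exact hle
  let μ : ℕ → ℝ := fun n => ‖compression K (S n)‖
  let u : ℕ → E := fun n => top (S n)
  have hμ : Antitone μ := fun m n h => norm_compression_le_of_le K (S_mono h)
  have hμ0 : ∀ n, 0 ≤ μ n := fun n => norm_nonneg _
  have hu : ∀ n, μ n ≠ 0 → u n ∈ (S n)ᗮ ∧ ‖u n‖ = 1 ∧ K (u n) = (μ n : 𝕜) • u n := fun n h =>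
    htop (S n) (S_inv n) (norm_ne_zero_iff.1 h)
  have hmem : ∀ m n, μ m ≠ 0 → m < n → u m ∈ S n := fun m n h hmn => by
    refine S_mono (Nat.succ_le_of_lt hmn) ?_
    rw [Nat.succ_eq_add_one, S_succ, if_neg (norm_ne_zero_iff.1 h)]
    exact Submodule.mem_sup_right (Submodule.mem_span_singleton_self _)
  have hortho : ∀ m n, μ m ≠ 0 → μ n ≠ 0 → m ≠ n → inner 𝕜 (u m) (u n) = 0 := by
    intro m n hm hn hmn
    rcases lt_or_gt_of_ne hmn with h | h
    · exact (hu n hn).1 _ (hmem m n hm h)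
    · exact inner_eq_zero_symm.1 ((hu m hm).1 _ (hmem n m hn h))
  -- N is the first index at which the norm of the compression is zero, or infinity.
  obtain ⟨N, hN⟩ : ∃ N : ℕ∞, ∀ n : ℕ, (n : ℕ∞) < N ↔ μ n ≠ 0 := by
    by_cases h : ∃ n, μ n = 0
    · refine ⟨(Nat.find h : ℕ), fun n => ?_⟩
      rw [Nat.cast_lt]
      refine ⟨fun hn => Nat.find_min h hn, fun hn => ?_⟩
      by_contra hlt
      exact hn (le_antisymm ((hμ (not_lt.1 hlt)).trans_eq (Nat.find_spec h)) (hμ0 n))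
    · push Not at h
      exact ⟨⊤, fun n => ⟨fun _ => h n, fun _ => ENat.natCast_lt_top n⟩⟩
  refine ⟨N, μ, u, ⟨⟨fun n => (hu n ((hN n).1 n.2)).2.1, fun m n hmn =>
    hortho m n ((hN m).1 m.2) ((hN n).1 n.2) fun h => hmn (Subtype.ext h)⟩, hμ,
    fun n hn => (hμ0 n).lt_of_ne' ((hN n).1 hn),
    fun n hn => by_contra fun h => hn.not_gt ((hN n).2 h),
    fun n hn => (hu n ((hN n).1 hn)).2.2, ?_⟩⟩
  intro t v ht hv
  set T := Submodule.span 𝕜 {w | ∃ n : ℕ, (n : ℕ∞) < N ∧ μ n = t ∧ u n = w} with hT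
  have hTe : T ≤ Module.End.eigenspace (K : E →ₗ[𝕜] E) (t : 𝕜) := by
    rw [hT, Submodule.span_le]
    rintro _ ⟨n, hn, rfl, rfl⟩
    exact Module.End.mem_eigenspace_iff.2 (hu n ((hN n).1 hn)).2.2
  have hfin : FiniteDimensional 𝕜 (Module.End.eigenspace (K : E →ₗ[𝕜] E) (t : 𝕜)) :=
    ContinuousLinearMap.finite_dimensional_eigenspace hK _ (by exact_mod_cast ht.ne')
  have : FiniteDimensional 𝕜 T := Submodule.finiteDimensional_of_le hTe
  -- The part of v missed by the selection. It is orthogonal to the selected eigenvectors for t by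
  -- construction, and to the others because their eigenvalues differ from t. If it were nonzero,
  -- every compression would have norm at least t, so infinitely many orthonormal eigenvectors would
  -- have eigenvalues at least t, which compactness forbids.
  set v' := v - T.starProjection v with hv'
  have hv'T : v' ∈ Tᗮ := Submodule.sub_starProjection_mem_orthogonal v
  have hKv' : K v' = (t : 𝕜) • v' := by
    have := Module.End.mem_eigenspace_iff.1 (hTe (Submodule.starProjection_apply_mem T v))
    change K _ = _ at this
    rw [hv', map_sub, hv, this, smul_sub]
  have horth : ∀ n, v' ∈ (S n)ᗮ := fun n => by
    induction n with
    | zero =>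
      intro y hy
      rw [(Submodule.mem_bot 𝕜).1 hy, inner_zero_left]
    | succ n ih =>
      rw [S_succ]
      split_ifs with h0
      · exact ih
      · rw [← Submodule.inf_orthogonal]
        refine Submodule.mem_inf.2 ⟨ih, ?_⟩
        have h0' : μ n ≠ 0 := norm_ne_zero_iff.2 h0
        rw [Submodule.mem_orthogonal_singleton_iff_inner_right]
        by_cases hnt : μ n = t
        · exact hv'T _ (Submodule.subset_span ⟨n, (hN n).2 h0', hnt, rfl⟩)
        · exact inner_eq_zero_of_eigenvalue_ne hpos (hu n h0').2.2 hKv' hnt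
  by_cases hv0 : v' = 0
  · rw [sub_eq_zero.1 hv0]
    exact Submodule.starProjection_apply_mem T v
  exfalso
  have hle : ∀ n, t ≤ μ n := fun n => by
    have h1 := (compression K (S n)).le_opNorm v'
    rw [compression_apply_of_mem hpos (S_inv n) (horth n), hKv', norm_smul, RCLike.norm_ofReal,
      abs_of_pos ht] at h1
    exact le_of_mul_le_mul_right h1 (norm_pos_iff.2 hv0)
  have hne : ∀ n, μ n ≠ 0 := fun n => (ht.trans_le (hle n)).ne'
  exact not_forall_le_of_orthonormal_eigenvectors hK
    ⟨fun n => (hu n (hne n)).2.1, fun m n hmn => hortho m n (hne m) (hne n) hmn⟩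
    (fun n => (hu n (hne n)).2.2) ht hle

end SpectralSystem

/-! ### Min-max comparison of eigenvalues, residual estimates and gaps. -/

section Comparison

variable {𝕜 E F : Type*} [RCLike 𝕜] [NormedAddCommGroup E] [InnerProductSpace 𝕜 E]
  [NormedAddCommGroup F] [InnerProductSpace 𝕜 F]

theorem Submodule.sub_starProjection_orthogonal_mem [CompleteSpace E] (S : Submodule 𝕜 E)
    [S.HasOrthogonalProjection] (x : E) : x - Sᗮ.starProjection x ∈ S := by
  have := Submodule.sub_starProjection_mem_orthogonal (K := Sᗮ) x
  rwa [Submodule.orthogonal_orthogonal] at this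

namespace IsSpectralSystem

variable {A : E →L[𝕜] E} {N : ℕ∞} {μ : ℕ → ℝ} {u : ℕ → E}

theorem nonneg (h : IsSpectralSystem (𝕜 := 𝕜) A N μ u) (n : ℕ) : 0 ≤ μ n := by
  rcases lt_or_ge (n : ℕ∞) N with hn | hn
  · exact (h.pos n hn).le
  · exact (h.eq_zero n hn).ge

theorem lt_of_pos (h : IsSpectralSystem (𝕜 := 𝕜) A N μ u) {n : ℕ} (hn : 0 < μ n) :
    (n : ℕ∞) < N :=
  lt_of_not_ge fun h' => hn.ne' (h.eq_zero n h')

theorem apply_mem_initialSpan (h : IsSpectralSystem (𝕜 := 𝕜) A N μ u) (m : ℕ) :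
    ∀ x ∈ initialSpan 𝕜 N u m, A x ∈ initialSpan 𝕜 N u m := by
  have hle : initialSpan 𝕜 N u m ≤ (initialSpan 𝕜 N u m).comap (A : E →ₗ[𝕜] E) := by
    conv_lhs => rw [initialSpan]
    rw [Submodule.span_le]
    rintro _ ⟨n, hnm, hn, rfl⟩
    change A (u n) ∈ initialSpan 𝕜 N u m
    rw [h.apply_eq n hn]
    exact Submodule.smul_mem _ _ (Submodule.subset_span ⟨n, hnm, hn, rfl⟩)
  exact hle

theorem orthonormal_fin (h : IsSpectralSystem (𝕜 := 𝕜) A N μ u) {m : ℕ} (hm : (m : ℕ∞) ≤ N) :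
    Orthonormal 𝕜 (fun j : Fin m => u j) :=
  h.orthonormal.comp (fun j : Fin m => ⟨j, (Nat.cast_lt.2 j.2).trans_le hm⟩)
    fun _ _ hab => Fin.ext (congrArg Subtype.val hab)

/-- The Rayleigh quotient on the span of the first `n + 1` eigenvectors. -/
theorem mul_norm_sq_le_re_inner (h : IsSpectralSystem (𝕜 := 𝕜) A N μ u) {n : ℕ}
    (hn : (n : ℕ∞) < N) (c : Fin (n + 1) → 𝕜) :
    μ n * ‖∑ j, c j • u j‖ ^ 2
      ≤ RCLike.re (inner 𝕜 (A (∑ j, c j • u j)) (∑ j, c j • u j)) := by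
  have hlt : ∀ j : Fin (n + 1), ((j : ℕ) : ℕ∞) < N := fun j =>
    lt_of_le_of_lt (Nat.cast_le.2 (Nat.lt_succ_iff.1 j.2)) hn
  have ho : Orthonormal 𝕜 (fun j : Fin (n + 1) => u j) :=
    h.orthonormal_fin (by exact_mod_cast Order.add_one_le_of_lt hn)
  have hA : A (∑ j, c j • u j) = ∑ j : Fin (n + 1), (c j * (μ j : 𝕜)) • u j := by
    rw [map_sum]
    refine Finset.sum_congr rfl fun j _ => ?_
    rw [map_smul, h.apply_eq j (hlt j), smul_smul]
  rw [hA, ho.inner_sum, norm_sq_eq_re_inner (𝕜 := 𝕜) (∑ j, c j • u j), ho.inner_sum,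
    map_sum, map_sum, Finset.mul_sum]
  refine Finset.sum_le_sum fun j _ => ?_
  have e1 : (starRingEnd 𝕜) (c j) * c j = ((‖c j‖ ^ 2 : ℝ) : 𝕜) := by
    rw [RCLike.conj_mul, RCLike.ofReal_pow]
  have e2 : (starRingEnd 𝕜) (c j * (μ j : 𝕜)) * c j = ((μ j * ‖c j‖ ^ 2 : ℝ) : 𝕜) := by
    rw [map_mul, RCLike.conj_ofReal, mul_right_comm, e1, ← RCLike.ofReal_mul, mul_comm]
  rw [e1, e2, RCLike.ofReal_re, RCLike.ofReal_re]
  exact mul_le_mul_of_nonneg_right (h.antitone (Nat.lt_succ_iff.1 j.2)) (sq_nonneg _)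

variable [CompleteSpace E]

/-- The Rayleigh quotient on the orthogonal complement of the first `m` eigenvectors. -/
theorem re_inner_le_mul_norm_sq (h : IsSpectralSystem (𝕜 := 𝕜) A N μ u)
    (hA : IsCompactOperator A) (hpos : A.IsPositive) (m : ℕ) {x : E}
    (hx : x ∈ (initialSpan 𝕜 N u m)ᗮ) :
    RCLike.re (inner 𝕜 (A x) x) ≤ μ m * ‖x‖ ^ 2 := by
  set S := initialSpan 𝕜 N u m with hS
  have hinv : ∀ x ∈ S, A x ∈ S := h.apply_mem_initialSpan m
  rw [← compression_apply_of_mem hpos hinv hx]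
  refine (re_inner_apply_le_norm_mul _ _).trans (mul_le_mul_of_nonneg_right ?_ (sq_nonneg _))
  by_cases h0 : compression A S = 0
  · rw [h0, norm_zero]
    exact h.nonneg m
  obtain ⟨w, hwS, hw1, hw⟩ := exists_eigenvector_compression hA hpos hinv h0
  -- If the norm exceeded `μ m`, its eigenvector w would lie in the span of eigenvectors with index
  -- below m, hence in both S and its orthogonal complement.
  by_contra! hlt
  have hmem := h.mem_span _ w (norm_pos_iff.2 h0) hw
  have hle : Submodule.span 𝕜 {w | ∃ n : ℕ, (n : ℕ∞) < N ∧ μ n = ‖compression A S‖ ∧ u n = w}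
      ≤ S := by
    rw [Submodule.span_le]
    rintro _ ⟨n, hn, hnμ, rfl⟩
    refine Submodule.subset_span ⟨n, ?_, hn, rfl⟩
    by_contra! hmn
    exact absurd (h.antitone hmn) (by rw [hnμ]; exact hlt.not_ge)
  have : inner 𝕜 w w = (0 : 𝕜) := hwS w (hle hmem)
  rw [inner_self_eq_zero] at this
  rw [this, norm_zero] at hw1
  exact zero_ne_one hw1

/-- Comparison of the eigenvalues of two positive compact operators by means of a map between
the spaces. -/
theorem le_mul_add_norm [CompleteSpace F] (hμ : IsSpectralSystem (𝕜 := 𝕜) A N μ u)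
    (hA : IsCompactOperator A) (hpos : A.IsPositive)
    {B : F →L[𝕜] F} {N' : ℕ∞} {μ' : ℕ → ℝ} {u' : ℕ → F}
    (hμ' : IsSpectralSystem (𝕜 := 𝕜) B N' μ' u') (j : F →L[𝕜] E) (n : ℕ) :
    μ' n ≤ ‖j‖ ^ 2 * μ n + ‖adjoint j ∘L A ∘L j - B‖ := by
  have hnn : 0 ≤ ‖j‖ ^ 2 * μ n := mul_nonneg (sq_nonneg _) (hμ.nonneg n)
  rcases le_or_gt N' (n : ℕ∞) with hn | hn
  · rw [hμ'.eq_zero n hn]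
    exact add_nonneg hnn (norm_nonneg _)
  let v : Fin (n + 1) → F := fun a => u' a
  -- The dimension count of min-max: n orthogonality conditions on `j x` for n + 1 coefficients of x
  -- leave a nonzero solution. Conditions from indices beyond N are harmless.
  let L : (Fin (n + 1) → 𝕜) →ₗ[𝕜] (Fin n → 𝕜) := LinearMap.pi fun a : Fin n =>
    (innerₛₗ 𝕜 (u a)) ∘ₗ (j : F →ₗ[𝕜] E) ∘ₗ Fintype.linearCombination 𝕜 v
  obtain ⟨c, hcL, hc0⟩ := (Submodule.ne_bot_iff _).1
    (L.ker_ne_bot_of_finrank_lt (by simp))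
  set x : F := ∑ a, c a • u' a with hx
  have hx0 : x ≠ 0 := fun h0 => hc0 (funext fun a =>
    Fintype.linearIndependent_iff.1 (hμ'.orthonormal_fin
      (by exact_mod_cast Order.add_one_le_of_lt hn)).linearIndependent c h0 a)
  have hjx : j x ∈ (initialSpan 𝕜 N u n)ᗮ := by
    have hle : initialSpan 𝕜 N u n ≤ (Submodule.span 𝕜 {j x})ᗮ := by
      rw [initialSpan, Submodule.span_le]
      rintro _ ⟨a, ha, -, rfl⟩
      refine Submodule.mem_orthogonal_singleton_iff_inner_left.2 ?_
      exact congrFun (LinearMap.mem_ker.1 hcL) ⟨a, ha⟩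
    intro y hy
    exact Submodule.mem_orthogonal_singleton_iff_inner_left.1 (hle hy)
  have h1 := hμ'.mul_norm_sq_le_re_inner hn c
  rw [← hx] at h1
  have h2 := hμ.re_inner_le_mul_norm_sq hA hpos n hjx
  have h3 : ‖j x‖ ^ 2 ≤ ‖j‖ ^ 2 * ‖x‖ ^ 2 := by
    rw [← mul_pow]
    exact pow_le_pow_left₀ (norm_nonneg _) (j.le_opNorm x) 2
  have h4 : RCLike.re (inner 𝕜 (B x) x) = RCLike.re (inner 𝕜 (A (j x)) (j x))
      - RCLike.re (inner 𝕜 ((adjoint j ∘L A ∘L j - B) x) x) := by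
    simp only [sub_apply, ContinuousLinearMap.comp_apply, inner_sub_left,
      ContinuousLinearMap.adjoint_inner_left, map_sub]
    ring
  have h5 : - RCLike.re (inner 𝕜 ((adjoint j ∘L A ∘L j - B) x) x)
      ≤ ‖adjoint j ∘L A ∘L j - B‖ * ‖x‖ ^ 2 := by
    have := re_inner_apply_le_norm_mul (-(adjoint j ∘L A ∘L j - B)) x
    rwa [norm_neg, neg_apply, inner_neg_left, map_neg] at this
  have hxpos : 0 < ‖x‖ ^ 2 := by positivity
  refine le_of_mul_le_mul_right ?_ hxpos
  have h6 : μ n * ‖j x‖ ^ 2 ≤ μ n * (‖j‖ ^ 2 * ‖x‖ ^ 2) :=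
    mul_le_mul_of_nonneg_left h3 (hμ.nonneg n)
  nlinarith

/-- An approximate eigenvector is close to the span of the first `m` eigenvectors if its
eigenvalue is larger than the remaining ones. -/
theorem mul_norm_starProjection_le (hμ : IsSpectralSystem (𝕜 := 𝕜) A N μ u)
    (hA : IsCompactOperator A) (hpos : A.IsPositive) {B : F →L[𝕜] F} (j : F →L[𝕜] E) (m : ℕ)
    {β : ℝ} {x : F} (hx : B x = (β : 𝕜) • x) :
    (β - μ m) * ‖(initialSpan 𝕜 N u m)ᗮ.starProjection (j x)‖ ≤ ‖A ∘L j - j ∘L B‖ * ‖x‖ := by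
  set S := initialSpan 𝕜 N u m
  set w := Sᗮ.starProjection (j x) with hw
  have hwS : w ∈ Sᗮ := Submodule.starProjection_apply_mem _ _
  have hsub : j x - w ∈ S := S.sub_starProjection_orthogonal_mem (j x)
  have e1 : inner 𝕜 (j x) w = inner 𝕜 w w := by
    rw [← sub_eq_zero, ← inner_sub_left]
    exact hwS _ hsub
  have e2 : inner 𝕜 (A (j x)) w = inner 𝕜 (A w) w := by
    rw [← sub_eq_zero, ← inner_sub_left, ← map_sub]
    exact hwS _ (hμ.apply_mem_initialSpan m _ hsub)
  -- Paired with w, only the component w of `j x` survives, since A preserves S. The right-hand side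
  -- is at most `(μ m - β) * ‖w‖ ^ 2`.
  have e3 : inner 𝕜 ((A ∘L j - j ∘L B) x) w = inner 𝕜 (A w) w - (β : 𝕜) * inner 𝕜 w w := by
    simp only [sub_apply, ContinuousLinearMap.comp_apply, inner_sub_left, hx,
      map_smul, inner_smul_left, RCLike.conj_ofReal, e1, e2]
  have h1 := hμ.re_inner_le_mul_norm_sq hA hpos m hwS
  have h2 : -RCLike.re (inner 𝕜 ((A ∘L j - j ∘L B) x) w) ≤ ‖A ∘L j - j ∘L B‖ * ‖x‖ * ‖w‖ :=
    calc _ ≤ ‖inner 𝕜 ((A ∘L j - j ∘L B) x) w‖ :=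
          (neg_le_abs _).trans (RCLike.abs_re_le_norm _)
      _ ≤ ‖(A ∘L j - j ∘L B) x‖ * ‖w‖ := norm_inner_le_norm _ _
      _ ≤ _ := mul_le_mul_of_nonneg_right (ContinuousLinearMap.le_opNorm _ _) (norm_nonneg _)
  rw [e3, map_sub, RCLike.re_ofReal_mul, ← norm_sq_eq_re_inner] at h2
  rcases (norm_nonneg w).eq_or_lt with h0 | h0
  · rw [← h0, mul_zero]
    positivity
  · refine le_of_mul_le_mul_right ?_ h0
    nlinarith

end IsSpectralSystem

theorem infDist_sum_smul_le (T : Submodule 𝕜 E) {α : Type*} [Fintype α] (c : α → 𝕜) (v z : α → E)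
    (hz : ∀ a, z a ∈ T) :
    Metric.infDist (∑ a, c a • v a) (T : Set E) ≤ ∑ a, ‖c a‖ * ‖v a - z a‖ := by
  refine (Metric.infDist_le_dist_of_mem
    (T.sum_mem fun a (_ : a ∈ Finset.univ) => T.smul_mem (c a) (hz a))).trans ?_
  rw [dist_eq_norm, ← Finset.sum_sub_distrib]
  refine (norm_sum_le _ _).trans (Finset.sum_le_sum fun a _ => ?_)
  rw [← smul_sub, norm_smul]

theorem Orthonormal.norm_coeff_le {α : Type*} [Fintype α] {v : α → E} (hv : Orthonormal 𝕜 v)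
    (c : α → 𝕜) (a : α) : ‖c a‖ ≤ ‖∑ b, c b • v b‖ := by
  rw [← hv.inner_right_fintype c a]
  simpa [hv.1 a] using norm_inner_le_norm (𝕜 := 𝕜) (v a) (∑ b, c b • v b)

theorem span_exists_lt_eq_span_range (u : ℕ → E) (m : ℕ) :
    Submodule.span 𝕜 {w | ∃ n < m, u n = w}
      = Submodule.span 𝕜 (Set.range fun j : Fin m => u j) := by
  congr 1
  ext w
  exact ⟨fun ⟨n, hn, e⟩ => ⟨⟨n, hn⟩, e⟩, fun ⟨n, e⟩ => ⟨n, n.2, e⟩⟩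

theorem initialSpan_eq_span_range {N : ℕ∞} (u : ℕ → E) {m : ℕ} (hm : (m : ℕ∞) ≤ N) :
    initialSpan 𝕜 N u m = Submodule.span 𝕜 (Set.range fun j : Fin m => u j) := by
  rw [← span_exists_lt_eq_span_range, initialSpan]
  congr 1
  ext w
  exact ⟨fun ⟨n, hn, _, e⟩ => ⟨n, hn, e⟩,
    fun ⟨n, hn, e⟩ => ⟨n, hn, (Nat.cast_lt.2 hn).trans_le hm, e⟩⟩

theorem subspaceGap_nonneg (A B : Submodule 𝕜 E) : 0 ≤ subspaceGap A B :=
  le_max_of_le_left (Real.iSup_nonneg fun _ => Metric.infDist_nonneg)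

/-- A bound for the gap between the span of an orthonormal family and the image of the span of
another one. -/
theorem subspaceGap_span_le {m : ℕ} {v : Fin m → E} {w : Fin m → F} (hv : Orthonormal 𝕜 v)
    (hw : Orthonormal 𝕜 w) (i : F →L[𝕜] E) {c : ℝ} (hc : ∀ y, ‖y‖ ≤ c * ‖i y‖)
    {z z' : Fin m → E} (hz : ∀ a, z a ∈ (Submodule.span 𝕜 (Set.range w)).map (i : F →ₗ[𝕜] E))
    (hz' : ∀ a, z' a ∈ Submodule.span 𝕜 (Set.range v)) :
    subspaceGap (Submodule.span 𝕜 (Set.range v))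
      ((Submodule.span 𝕜 (Set.range w)).map (i : F →ₗ[𝕜] E))
      ≤ ∑ a, ‖v a - z a‖ + ∑ a, c * ‖i (w a) - z' a‖ := by
  have h1 : 0 ≤ ∑ a, ‖v a - z a‖ := Finset.sum_nonneg fun _ _ => norm_nonneg _
  have hc0 : ∀ a, 0 ≤ c * ‖i (w a) - z' a‖ := fun a => by
    have hca := hc (w a)
    rw [hw.1 a] at hca
    have : 0 ≤ c := by
      by_contra! h
      nlinarith [norm_nonneg (i (w a))]
    positivity
  have h2 : 0 ≤ ∑ a, c * ‖i (w a) - z' a‖ := Finset.sum_nonneg fun a _ => hc0 a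
  refine max_le ?_ ?_
  · refine Real.iSup_le ?_ (add_nonneg h1 h2)
    rintro ⟨x, hx, hx1⟩
    obtain ⟨b, rfl⟩ := (Submodule.mem_span_range_iff_exists_fun 𝕜).1 hx
    refine (infDist_sum_smul_le _ b v z hz).trans (le_add_of_le_of_nonneg ?_ h2)
    refine Finset.sum_le_sum fun a _ => ?_
    exact mul_le_of_le_one_left (norm_nonneg _) ((hv.norm_coeff_le b a).trans_eq hx1)
  · refine Real.iSup_le ?_ (add_nonneg h1 h2)
    rintro ⟨x, hx, hx1⟩
    obtain ⟨y, hy, rfl⟩ := hx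
    obtain ⟨b, rfl⟩ := (Submodule.mem_span_range_iff_exists_fun 𝕜).1 hy
    -- Here the image under i, not its preimage, is the unit vector, so the coefficients are bounded
    -- only by c.
    have hb : ∀ a, ‖b a‖ ≤ c := fun a => by
      refine (hw.norm_coeff_le b a).trans ((hc _).trans_eq ?_)
      rw [show ‖i (∑ b_1, b b_1 • w b_1)‖ = 1 from hx1, mul_one]
    have e : (i : F →ₗ[𝕜] E) (∑ a, b a • w a) = ∑ a, b a • i (w a) := by
      rw [map_sum]
      exact Finset.sum_congr rfl fun a _ => map_smul i _ _
    simp only [e]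
    refine (infDist_sum_smul_le _ b _ z' hz').trans (le_add_of_nonneg_of_le h1 ?_)
    exact Finset.sum_le_sum fun a _ => mul_le_mul_of_nonneg_right (hb a) (norm_nonneg _)

end Comparison

/-! ### Spectral convergence on varying spaces. -/

section SpectralConvergence

/-- Convergence of positive compact operators on varying spaces, almost isometrically embedded
in a fixed space. -/
structure ResolventsConverge {𝕜 ι E : Type*} [RCLike 𝕜] (l : Filter ι)
    [NormedAddCommGroup E] [InnerProductSpace 𝕜 E] [CompleteSpace E]
    {F : ι → Type*} [∀ h, NormedAddCommGroup (F h)] [∀ h, InnerProductSpace 𝕜 (F h)]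
    [∀ h, CompleteSpace (F h)] (i : ∀ h, F h →L[𝕜] E)
    (K : E →L[𝕜] E) (Kh : ∀ h, F h →L[𝕜] F h) (c : ℝ) : Prop where
  compact : IsCompactOperator K
  positive : K.IsPositive
  compact_discrete : ∀ h, IsCompactOperator (Kh h)
  positive_discrete : ∀ h, (Kh h).IsPositive
  nonneg : 0 ≤ c
  norm_embed_le : ∀ h, ‖i h‖ ≤ c
  norm_le_mul : ∀ h y, ‖y‖ ≤ c * ‖i h y‖
  norm_discrete_le : ∀ h, ‖Kh h‖ ≤ c
  tendsto_gram : Tendsto (fun h => ‖ContinuousLinearMap.id 𝕜 (F h) - adjoint (i h) ∘L i h‖) l (𝓝 0)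
  tendsto_norm : Tendsto (fun h => ‖K - i h ∘L Kh h ∘L adjoint (i h)‖) l (𝓝 0)
  tendsto_apply : ∀ x, Tendsto (fun h => ‖x - i h (adjoint (i h) x)‖) l (𝓝 0)

namespace ResolventsConverge

variable {𝕜 ι E : Type*} [RCLike 𝕜] {l : Filter ι}
    [NormedAddCommGroup E] [InnerProductSpace 𝕜 E] [CompleteSpace E]
    {F : ι → Type*} [∀ h, NormedAddCommGroup (F h)] [∀ h, InnerProductSpace 𝕜 (F h)]
    [∀ h, CompleteSpace (F h)] {i : ∀ h, F h →L[𝕜] E}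
    {K : E →L[𝕜] E} {Kh : ∀ h, F h →L[𝕜] F h} {c : ℝ}

/-- With K_h = `Kh h`, the commutator is (K - i K_h i*) i - i K_h (I - i* i), and both terms are
small. -/
theorem tendsto_commutator (H : ResolventsConverge l i K Kh c) :
    Tendsto (fun h => ‖K ∘L i h - i h ∘L Kh h‖) l (𝓝 0) := by
  have h0 := (H.tendsto_norm.mul_const c).add (H.tendsto_gram.const_mul (c * c))
  simp only [zero_mul, mul_zero, add_zero] at h0
  refine squeeze_zero (fun _ => norm_nonneg _) (fun h => ?_) h0
  have e : K ∘L i h - i h ∘L Kh h = (K - i h ∘L Kh h ∘L adjoint (i h)) ∘L i h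
      - i h ∘L Kh h ∘L (ContinuousLinearMap.id 𝕜 (F h) - adjoint (i h) ∘L i h) := by
    ext x
    simp
  rw [e]
  have hc := H.nonneg
  refine (norm_sub_le _ _).trans (add_le_add ?_ ?_)
  · exact (ContinuousLinearMap.opNorm_comp_le _ _).trans (by gcongr; exact H.norm_embed_le h)
  · calc _ ≤ ‖i h‖ * (‖Kh h‖ * ‖ContinuousLinearMap.id 𝕜 (F h) - adjoint (i h) ∘L i h‖) :=
        (ContinuousLinearMap.opNorm_comp_le _ _).trans
          (mul_le_mul_of_nonneg_left (ContinuousLinearMap.opNorm_comp_le _ _) (norm_nonneg _))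
      _ ≤ c * (c * ‖ContinuousLinearMap.id 𝕜 (F h) - adjoint (i h) ∘L i h‖) := by
        gcongr
        · exact H.norm_embed_le h
        · exact H.norm_discrete_le h
      _ = _ := by ring

/-- Both operators are self-adjoint, so one commutator estimate serves to transport eigenvectors by
i and by i*. -/
theorem norm_adjoint_commutator (H : ResolventsConverge l i K Kh c) (h : ι) :
    ‖Kh h ∘L adjoint (i h) - adjoint (i h) ∘L K‖ = ‖K ∘L i h - i h ∘L Kh h‖ := by
  rw [← norm_neg, ← LinearIsometryEquiv.norm_map adjoint (K ∘L i h - i h ∘L Kh h), map_sub,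
    ContinuousLinearMap.adjoint_comp, ContinuousLinearMap.adjoint_comp,
    H.positive.isSelfAdjoint.adjoint_eq, (H.positive_discrete h).isSelfAdjoint.adjoint_eq, neg_sub]

theorem tendsto_pullback (H : ResolventsConverge l i K Kh c) :
    Tendsto (fun h => ‖adjoint (i h) ∘L K ∘L i h - Kh h‖) l (𝓝 0) := by
  have h0 := (H.tendsto_commutator.const_mul c).add (H.tendsto_gram.mul_const c)
  simp only [zero_mul, mul_zero, add_zero] at h0
  refine squeeze_zero (fun _ => norm_nonneg _) (fun h => ?_) h0
  have e : adjoint (i h) ∘L K ∘L i h - Kh h = adjoint (i h) ∘L (K ∘L i h - i h ∘L Kh h)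
      - (ContinuousLinearMap.id 𝕜 (F h) - adjoint (i h) ∘L i h) ∘L Kh h := by
    ext x
    simp
  rw [e]
  refine (norm_sub_le _ _).trans (add_le_add ?_ ?_)
  · refine (ContinuousLinearMap.opNorm_comp_le _ _).trans ?_
    rw [LinearIsometryEquiv.norm_map]
    gcongr
    exact H.norm_embed_le h
  · refine (ContinuousLinearMap.opNorm_comp_le _ _).trans ?_
    gcongr
    exact H.norm_discrete_le h

/-- ‖i‖² = ‖i* i‖, and i* i is near the identity. The crude bound c² would not do: the factor in the
eigenvalue comparison has to tend to 1. -/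
theorem norm_embed_sq_le (h : ι) :
    ‖i h‖ ^ 2 ≤ 1 + ‖ContinuousLinearMap.id 𝕜 (F h) - adjoint (i h) ∘L i h‖ := by
  rw [sq, ← ContinuousLinearMap.norm_adjoint_comp_self]
  calc ‖adjoint (i h) ∘L i h‖ = ‖ContinuousLinearMap.id 𝕜 (F h)
        - (ContinuousLinearMap.id 𝕜 (F h) - adjoint (i h) ∘L i h)‖ := by rw [sub_sub_cancel]
    _ ≤ _ := (norm_sub_le _ _).trans
      (add_le_add_left ContinuousLinearMap.norm_id_le _)

variable {N : ℕ∞} {μ : ℕ → ℝ} {u : ℕ → E} {Nh : ι → ℕ∞} {μh : ι → ℕ → ℝ} {uh : ∀ h, ℕ → F h}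

/-- The min-max comparison along i bounds the discrete eigenvalues from above; along i*, with the
roles exchanged, it bounds them from below. -/
theorem tendsto_eigenvalue (H : ResolventsConverge l i K Kh c)
    (hμ : IsSpectralSystem (𝕜 := 𝕜) K N μ u)
    (hμh : ∀ h, IsSpectralSystem (𝕜 := 𝕜) (Kh h) (Nh h) (μh h) (uh h)) (n : ℕ) :
    Tendsto (fun h => μh h n) l (𝓝 (μ n)) := by
  set δ : ι → ℝ := fun h => ‖ContinuousLinearMap.id 𝕜 (F h) - adjoint (i h) ∘L i h‖
  have hδ : Tendsto δ l (𝓝 0) := H.tendsto_gram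
  have hδ1 : Tendsto (fun h => 1 + δ h) l (𝓝 1) := by simpa using hδ.const_add 1
  have hpos : ∀ h, 0 < 1 + δ h := fun h => by positivity
  have up : ∀ h, μh h n ≤ (1 + δ h) * μ n + ‖adjoint (i h) ∘L K ∘L i h - Kh h‖ := fun h =>
    (hμ.le_mul_add_norm H.compact H.positive (hμh h) (i h) n).trans
      (add_le_add_left (mul_le_mul_of_nonneg_right (norm_embed_sq_le h) (hμ.nonneg n)) _)
  have low : ∀ h, (μ n - ‖K - i h ∘L Kh h ∘L adjoint (i h)‖) / (1 + δ h) ≤ μh h n := fun h => by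
    rw [div_le_iff₀ (hpos h), sub_le_iff_le_add, mul_comm]
    have := (hμh h).le_mul_add_norm (H.compact_discrete h) (H.positive_discrete h) hμ
      (adjoint (i h)) n
    rw [ContinuousLinearMap.adjoint_adjoint, LinearIsometryEquiv.norm_map, norm_sub_rev] at this
    exact this.trans
      (add_le_add_left (mul_le_mul_of_nonneg_right (norm_embed_sq_le h) ((hμh h).nonneg n)) _)
  refine tendsto_of_tendsto_of_tendsto_of_le_of_le ?_ ?_ low up
  · have := (H.tendsto_norm.const_sub (μ n)).div hδ1 one_ne_zero
    rwa [sub_zero, div_one] at this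
  · simpa using (hδ1.mul_const (μ n)).add H.tendsto_pullback

/-- A discrete value with positive limit is eventually positive, so it is not one of the zeros
continuing the list. -/
theorem eventually_le_card (H : ResolventsConverge l i K Kh c)
    (hμ : IsSpectralSystem (𝕜 := 𝕜) K N μ u)
    (hμh : ∀ h, IsSpectralSystem (𝕜 := 𝕜) (Kh h) (Nh h) (μh h) (uh h)) {m : ℕ}
    (hm : (m : ℕ∞) ≤ N) : ∀ᶠ h in l, (m : ℕ∞) ≤ Nh h := by
  cases m with
  | zero => exact Eventually.of_forall fun h => by simp
  | succ n =>
    have hn : (n : ℕ∞) < N := (Nat.cast_lt.2 (Nat.lt_succ_self n)).trans_le hm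
    filter_upwards [(H.tendsto_eigenvalue hμ hμh n).eventually_const_lt (hμ.pos n hn)] with h hh
    exact_mod_cast Order.add_one_le_of_lt ((hμh h).lt_of_pos hh)

theorem tendsto_gap (H : ResolventsConverge l i K Kh c)
    (hμ : IsSpectralSystem (𝕜 := 𝕜) K N μ u)
    (hμh : ∀ h, IsSpectralSystem (𝕜 := 𝕜) (Kh h) (Nh h) (μh h) (uh h)) {m : ℕ}
    (hm : (m : ℕ∞) ≤ N) (hgap : ∀ a < m, μ m < μ a) :
    Tendsto (fun h => subspaceGap (Submodule.span 𝕜 {w | ∃ n < m, u n = w})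
      ((Submodule.span 𝕜 {w | ∃ n < m, uh h n = w}).map (i h : F h →ₗ[𝕜] E))) l (𝓝 0) := by
  simp only [span_exists_lt_eq_span_range]
  have hc := H.nonneg
  set ε : ι → ℝ := fun h => ‖K ∘L i h - i h ∘L Kh h‖
  have hε : Tendsto ε l (𝓝 0) := H.tendsto_commutator
  have hev := H.eventually_le_card hμ hμh hm
  have hlim := H.tendsto_eigenvalue hμ hμh
  have hmN : ∀ a : Fin m, ((a : ℕ) : ℕ∞) < N := fun a => (Nat.cast_lt.2 a.2).trans_le hm
  -- Each eigenvector is approximated by transporting it (by i* or by i) and projecting onto the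
  -- other initial span. The residual estimate bounds what the projection removes by the commutator
  -- over a difference of eigenvalues, which tends to `μ a - μ m > 0`.
  let z : ι → Fin m → E := fun h a => i h (adjoint (i h) (u a)
    - (initialSpan 𝕜 (Nh h) (uh h) m)ᗮ.starProjection (adjoint (i h) (u a)))
  let z' : ι → Fin m → E := fun h a => i h (uh h a)
    - (initialSpan 𝕜 N u m)ᗮ.starProjection (i h (uh h a))
  have hz : ∀ a : Fin m, Tendsto (fun h => ‖u a - z h a‖) l (𝓝 0) := fun a => by
    have hpos : 0 < μ a - μ m := sub_pos.2 (hgap a a.2)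
    have hd : Tendsto (fun h => μ a - μh h m) l (𝓝 (μ a - μ m)) := (hlim m).const_sub _
    have h0 := (H.tendsto_apply (u a)).add ((hε.div hd hpos.ne').const_mul c)
    simp only [zero_div, mul_zero, add_zero] at h0
    refine squeeze_zero' (Eventually.of_forall fun _ => norm_nonneg _) ?_ h0
    filter_upwards [hd.eventually_const_lt hpos] with h hh
    have e : u a - z h a = (u a - i h (adjoint (i h) (u a)))
        + i h ((initialSpan 𝕜 (Nh h) (uh h) m)ᗮ.starProjection (adjoint (i h) (u a))) := by
      simp only [z, map_sub]
      abel
    rw [e]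
    refine (norm_add_le _ _).trans (add_le_add_right ?_ _)
    refine ((i h).le_opNorm _).trans (mul_le_mul (H.norm_embed_le h) ?_ (norm_nonneg _) hc)
    simp only [Pi.div_apply]
    rw [le_div_iff₀ hh, mul_comm]
    refine ((hμh h).mul_norm_starProjection_le (H.compact_discrete h) (H.positive_discrete h)
      (adjoint (i h)) m (hμ.apply_eq a (hmN a))).trans_eq ?_
    rw [H.norm_adjoint_commutator h, (hμ.orthonormal_fin hm).1 a, mul_one]
  have hz' : ∀ a : Fin m, Tendsto (fun h => c * ‖i h (uh h a) - z' h a‖) l (𝓝 0) := fun a => by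
    have hpos : 0 < μ a - μ m := sub_pos.2 (hgap a a.2)
    have hd : Tendsto (fun h => μh h a - μ m) l (𝓝 (μ a - μ m)) := (hlim a).sub_const _
    have h0 := (hε.div hd hpos.ne').const_mul c
    simp only [zero_div, mul_zero] at h0
    refine squeeze_zero' (Eventually.of_forall fun _ => by positivity) ?_ h0
    filter_upwards [hd.eventually_const_lt hpos, hev] with h hh hmh
    refine mul_le_mul_of_nonneg_left ?_ hc
    simp only [z', sub_sub_cancel, Pi.div_apply]
    rw [le_div_iff₀ hh, mul_comm]
    refine (hμ.mul_norm_starProjection_le H.compact H.positive (i h) m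
      ((hμh h).apply_eq a ((Nat.cast_lt.2 a.2).trans_le hmh))).trans_eq ?_
    rw [((hμh h).orthonormal_fin hmh).1 a, mul_one]
  have h0 := (tendsto_finsetSum Finset.univ fun a _ => hz a).add
    (tendsto_finsetSum Finset.univ fun a _ => hz' a)
  simp only [Finset.sum_const_zero, add_zero] at h0
  refine squeeze_zero' (Eventually.of_forall fun _ => subspaceGap_nonneg _ _) ?_ h0
  filter_upwards [hev] with h hmh
  refine subspaceGap_span_le (hμ.orthonormal_fin hm) ((hμh h).orthonormal_fin hmh) (i h)
    (H.norm_le_mul h) (fun a => ?_) (fun a => ?_)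
  · rw [← initialSpan_eq_span_range (uh h) hmh]
    exact Submodule.mem_map_of_mem (Submodule.sub_starProjection_orthogonal_mem _ _)
  · rw [← initialSpan_eq_span_range u hm]
    exact Submodule.sub_starProjection_orthogonal_mem _ _

end ResolventsConverge

end SpectralConvergence

namespace HilbertComplex

/-! ### Partial inverses of the differentials and their compactness. -/

section PartialInverse

variable {𝕜 : Type*} [RCLike 𝕜]
  {W : ℤ → Type*} [∀ k, NormedAddCommGroup (W k)] [∀ k, InnerProductSpace 𝕜 (W k)]
  [∀ k, CompleteSpace (W k)] (C : HilbertComplex 𝕜 W)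

theorem mem_cocycles {k : ℤ} {u : W k} :
    u ∈ C.cocycles k ↔ ∃ hu : u ∈ (C.d k).domain, C.d k ⟨u, hu⟩ = 0 := by
  constructor
  · rintro ⟨v, hv, rfl⟩
    exact ⟨v.2, hv⟩
  · rintro ⟨hu, h⟩
    exact ⟨⟨u, hu⟩, h, rfl⟩

theorem d_mem_coboundaries {k : ℤ} (v : (C.d k).domain) : C.d k v ∈ C.coboundaries k :=
  ⟨v, rfl⟩

theorem coboundaries_le_cocycles (k : ℤ) : C.coboundaries k ≤ C.cocycles (k + 1) := by
  rintro _ ⟨v, rfl⟩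
  exact C.mem_cocycles.2 ⟨C.d_mem k v, C.d_d k v⟩

theorem isClosed_cocycles (k : ℤ) : IsClosed (C.cocycles k : Set (W k)) := by
  have h : (C.cocycles k : Set (W k))
      = (fun u => (u, (0 : W (k + 1)))) ⁻¹' ((C.d k).graph : Set (W k × W (k + 1))) := by
    ext u
    simp only [SetLike.mem_coe, Set.mem_preimage, LinearPMap.mem_graph_iff, mem_cocycles]
    constructor
    · rintro ⟨hu, h⟩
      exact ⟨⟨u, hu⟩, rfl, h⟩
    · rintro ⟨v, rfl, h⟩
      exact ⟨v.2, h⟩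
  rw [h]
  exact IsClosed.preimage (by fun_prop) (C.isClosed_d k)

instance (k : ℤ) : CompleteSpace (C.cocycles k) := (C.isClosed_cocycles k).completeSpace_coe

/-- `T` is the partial inverse of `d k`: it maps `g` to the element of minimal norm among those
that `d k` maps to the orthogonal projection of `g` onto the coboundaries. -/
structure IsPartialInverse (k : ℤ) (T : W (k + 1) →L[𝕜] W k) : Prop where
  mem_domain : ∀ g, T g ∈ (C.d k).domain
  sub_d_mem : ∀ g, g - C.d k ⟨T g, mem_domain g⟩ ∈ (C.coboundaries k)ᗮ
  mem_orthogonal : ∀ g, T g ∈ (C.cocycles k)ᗮ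

variable {C}

/-- The image of z - z' lies in 𝔅 ∩ 𝔅^⊥, hence z - z' lies in ℨ ∩ ℨ^⊥. This uniqueness also yields
the linearity of the partial inverse. -/
theorem eq_of_sub_d_mem_orthogonal {k : ℤ} {g : W (k + 1)} {z z' : (C.d k).domain}
    (h : g - C.d k z ∈ (C.coboundaries k)ᗮ) (h' : g - C.d k z' ∈ (C.coboundaries k)ᗮ)
    (hz : (z : W k) ∈ (C.cocycles k)ᗮ) (hz' : (z' : W k) ∈ (C.cocycles k)ᗮ) :
    (z : W k) = z' := by
  have h1 : C.d k (z - z') ∈ (C.coboundaries k)ᗮ := by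
    have := sub_mem h' h
    rwa [sub_sub_sub_cancel_left, ← LinearPMap.map_sub] at this
  have h2 : C.d k (z - z') = 0 := by
    rw [← inner_self_eq_zero (𝕜 := 𝕜)]
    exact h1 _ (C.d_mem_coboundaries _)
  have h3 : ((z - z' : (C.d k).domain) : W k) ∈ C.cocycles k :=
    C.mem_cocycles.2 ⟨(z - z').2, h2⟩
  have h4 : ((z - z' : (C.d k).domain) : W k) ∈ (C.cocycles k)ᗮ := sub_mem hz hz'
  rw [← sub_eq_zero, ← inner_self_eq_zero (𝕜 := 𝕜)]
  exact h4 _ h3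

theorem exists_sub_d_mem_orthogonal {k : ℤ} (hB : IsClosed (C.coboundaries k : Set (W (k + 1))))
    (g : W (k + 1)) : ∃ z : (C.d k).domain, g - C.d k z ∈ (C.coboundaries k)ᗮ ∧
      (z : W k) ∈ (C.cocycles k)ᗮ := by
  have : CompleteSpace (C.coboundaries k) := hB.completeSpace_coe
  obtain ⟨v, hv⟩ := Submodule.starProjection_apply_mem (C.coboundaries k) g
  change C.d k v = _ at hv
  obtain ⟨h1, h2⟩ := C.mem_cocycles.1 (Submodule.starProjection_apply_mem (C.cocycles k) (v : W k))
  refine ⟨v - ⟨_, h1⟩, ?_, Submodule.sub_starProjection_mem_orthogonal _⟩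
  rw [LinearPMap.map_sub, h2, sub_zero, hv]
  exact Submodule.sub_starProjection_mem_orthogonal _

theorem exists_isPartialInverse {k : ℤ} (hB : IsClosed (C.coboundaries k : Set (W (k + 1)))) :
    ∃ T, C.IsPartialInverse k T := by
  have : CompleteSpace (C.coboundaries k) := hB.completeSpace_coe
  choose f hf hf' using exists_sub_d_mem_orthogonal (C := C) hB
  let L : W (k + 1) →ₗ[𝕜] W k :=
    { toFun := fun g => f g
      map_add' := fun a b => by
        refine eq_of_sub_d_mem_orthogonal (z' := f a + f b) (hf (a + b)) ?_ (hf' _)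
          (add_mem (hf' a) (hf' b))
        rw [LinearPMap.map_add, add_sub_add_comm]
        exact add_mem (hf a) (hf b)
      map_smul' := fun c a => by
        refine eq_of_sub_d_mem_orthogonal (z' := c • f a) (hf (c • a)) ?_ (hf' _)
          (Submodule.smul_mem _ _ (hf' a))
        rw [LinearPMap.map_smul, ← smul_sub]
        exact Submodule.smul_mem _ _ (hf a) }
  have hd : ∀ g, C.d k (f g) = (C.coboundaries k).starProjection g := fun g =>
    (Submodule.eq_starProjection_of_mem_orthogonal (C.d_mem_coboundaries _) (hf g)).symm
  have hL : Continuous L := by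
    -- Closed graph theorem: along the sequence the values of `d k` are the projections onto 𝔅 and
    -- converge, so closedness of `d k` puts y in its domain, and uniqueness identifies y with `L
    -- x`.
    refine L.continuous_of_seq_closed_graph fun s x y hs hy => ?_
    have hlim : Tendsto (fun n => ((f (s n) : W k), C.d k (f (s n)))) atTop
        (𝓝 (y, (C.coboundaries k).starProjection x)) := by
      refine Tendsto.prodMk_nhds hy ?_
      simp only [hd]
      exact ((ContinuousLinearMap.continuous _).tendsto x).comp hs
    have hmem := (C.isClosed_d k).mem_of_tendsto hlim
      (Eventually.of_forall fun n => (C.d k).mem_graph (f (s n)))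
    obtain ⟨z, hz1, hz2⟩ := LinearPMap.mem_graph_iff _ |>.1 hmem
    have hz1' : (z : W k) = y := hz1
    have hyZ : y ∈ (C.cocycles k)ᗮ :=
      (Submodule.isClosed_orthogonal _).mem_of_tendsto hy (Eventually.of_forall fun n => hf' (s n))
    rw [← hz1']
    refine eq_of_sub_d_mem_orthogonal (g := x) ?_ (hf x) (hz1' ▸ hyZ) (hf' x)
    rw [show C.d k z = _ from hz2]
    exact Submodule.sub_starProjection_mem_orthogonal _
  exact ⟨⟨L, hL⟩, fun g => (f g).2, hf, hf'⟩

namespace IsPartialInverse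

variable {k : ℤ} {T : W (k + 1) →L[𝕜] W k}

theorem eq_apply (hT : C.IsPartialInverse k T) {g : W (k + 1)} {z : (C.d k).domain}
    (h : g - C.d k z ∈ (C.coboundaries k)ᗮ) (hz : (z : W k) ∈ (C.cocycles k)ᗮ) : T g = z :=
  eq_of_sub_d_mem_orthogonal (z := ⟨T g, hT.mem_domain g⟩) (hT.sub_d_mem g) h
    (hT.mem_orthogonal g) hz

theorem d_apply (hT : C.IsPartialInverse k T) {g : W (k + 1)} (hg : g ∈ C.coboundaries k) :
    C.d k ⟨T g, hT.mem_domain g⟩ = g := by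
  have h := hT.sub_d_mem g _ (sub_mem hg (C.d_mem_coboundaries ⟨T g, hT.mem_domain g⟩))
  exact (sub_eq_zero.1 (inner_self_eq_zero.1 h)).symm

theorem apply_eq_zero (hT : C.IsPartialInverse k T) {g : W (k + 1)}
    (hg : g ∈ (C.coboundaries k)ᗮ) : T g = 0 :=
  hT.eq_apply (z := 0) (by rwa [LinearPMap.map_zero, sub_zero]) (zero_mem _)

theorem sub_apply_d_mem (hT : C.IsPartialInverse k T) (v : (C.d k).domain) :
    (v : W k) - T (C.d k v) ∈ C.cocycles k := by
  refine C.mem_cocycles.2 ⟨sub_mem v.2 (hT.mem_domain _), ?_⟩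
  change C.d k (v - ⟨T (C.d k v), hT.mem_domain _⟩) = 0
  rw [LinearPMap.map_sub, hT.d_apply (C.d_mem_coboundaries v), sub_self]

theorem adjoint_mem (hT : C.IsPartialInverse k T)
    (hB : IsClosed (C.coboundaries k : Set (W (k + 1)))) (y : W k) :
    adjoint T y ∈ C.coboundaries k := by
  have : CompleteSpace (C.coboundaries k) := hB.completeSpace_coe
  rw [← Submodule.orthogonal_orthogonal (C.coboundaries k)]
  intro g hg
  rw [ContinuousLinearMap.adjoint_inner_right, hT.apply_eq_zero hg, inner_zero_left]

end IsPartialInverse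

/-- T g lies in ℨ^⊥ ⊆ 𝔅^⊥, so d* T g = 0, while d T g is a projection of g. Hence T maps the ball of
radius (‖T‖² + 1)^(-1/2) into the unit ball of V ∩ V*. -/
theorem IsPartialInverse.isCompactOperator_succ {k : ℤ} {T : W (k + 1 + 1) →L[𝕜] W (k + 1)}
    (hT : C.IsPartialInverse (k + 1) T)
    (hB : IsClosed (C.coboundaries (k + 1) : Set (W (k + 1 + 1))))
    (hcompact : C.CompactnessProperty) : IsCompactOperator T := by
  have : CompleteSpace (C.coboundaries (k + 1)) := hB.completeSpace_coe
  have hr : 0 < Real.sqrt (‖T‖ ^ 2 + 1) := by positivity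
  refine (isCompactOperator_iff_image_closedBall_subset_compact
    (T : W (k + 1 + 1) →ₗ[𝕜] W (k + 1)) (inv_pos.2 hr)).2 ⟨_, hcompact k, ?_⟩
  rintro _ ⟨g, hg, rfl⟩
  change T g ∈ _
  refine subset_closure ?_
  have hzero : ∀ x : (C.d k).domain,
      inner 𝕜 (0 : W k) (x : W k) = inner 𝕜 (T g) (C.d k x) := fun x => by
    rw [inner_zero_left]
    exact ((Submodule.mem_orthogonal' _ _).1 (hT.mem_orthogonal g) _
      (C.coboundaries_le_cocycles k (C.d_mem_coboundaries x))).symm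
  have hadj : T g ∈ (C.d k).adjoint.domain :=
    LinearPMap.mem_adjoint_domain_of_exists _ ⟨0, hzero⟩
  refine ⟨hT.mem_domain g, hadj, ?_⟩
  rw [LinearPMap.adjoint_apply_eq (C.dense_domain k) ⟨T g, hadj⟩ hzero, norm_zero]
  have hd : C.d (k + 1) ⟨T g, hT.mem_domain g⟩ = (C.coboundaries (k + 1)).starProjection g :=
    (Submodule.eq_starProjection_of_mem_orthogonal (C.d_mem_coboundaries _) (hT.sub_d_mem g)).symm
  have h1 : ‖C.d (k + 1) ⟨T g, hT.mem_domain g⟩‖ ≤ ‖g‖ := by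
    rw [hd]
    exact Submodule.norm_starProjection_apply_le _ g
  have h2 := T.le_opNorm g
  have h3 : ‖g‖ ≤ (Real.sqrt (‖T‖ ^ 2 + 1))⁻¹ := mem_closedBall_zero_iff.1 hg
  have h4 : ‖g‖ ^ 2 * (‖T‖ ^ 2 + 1) ≤ 1 := by
    rw [← one_div, le_div_iff₀ hr] at h3
    have := pow_le_pow_left₀ (by positivity) h3 2
    rwa [mul_pow, Real.sq_sqrt (by positivity), one_pow] at this
  have h5 : ‖T g‖ ^ 2 ≤ (‖T‖ * ‖g‖) ^ 2 := pow_le_pow_left₀ (norm_nonneg _) h2 2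
  have h6 := pow_le_pow_left₀ (norm_nonneg _) h1 2
  nlinarith

theorem IsPartialInverse.isCompactOperator {k : ℤ} {T : W (k + 1) →L[𝕜] W k}
    (hT : C.IsPartialInverse k T) (hB : IsClosed (C.coboundaries k : Set (W (k + 1))))
    (hcompact : C.CompactnessProperty) : IsCompactOperator T := by
  -- `CompactnessProperty` concerns degrees written as j + 1, which over ℤ are all degrees.
  obtain ⟨j, rfl⟩ : ∃ j, k = j + 1 := ⟨k - 1, by ring⟩
  exact hT.isCompactOperator_succ hB hcompact

end PartialInverse

/-! ### The solution operator of the mixed problem. -/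

section SolutionOperator

variable {𝕜 : Type*} [RCLike 𝕜]
  {W : ℤ → Type*} [∀ k, NormedAddCommGroup (W k)] [∀ k, InnerProductSpace 𝕜 (W k)]
  [∀ k, CompleteSpace (W k)] {C : HilbertComplex 𝕜 W} {k : ℤ}

/-- Energy argument: testing with v = u and τ = σ gives ‖σ‖² + ‖du‖² = 0. So u is a cocycle
orthogonal to 𝔅, thus harmonic, and the third equation makes it orthogonal to itself. -/
theorem IsMixedSolution.eq_zero {σ : (C.d k).domain} {u : (C.d (k + 1)).domain} {p : C.harmonic k}
    (h : C.IsMixedSolution k 0 σ u p) : (u : W (k + 1)) = 0 := by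
  obtain ⟨h1, h2, h3⟩ := h
  have hp : (p : W (k + 1)) ∈ (C.coboundaries k)ᗮ := p.2.2
  have hu : C.d (k + 1) u = 0 := by
    have hpu : inner 𝕜 (p : W (k + 1)) (u : W (k + 1)) = 0 := inner_eq_zero_symm.1 (h3 p)
    have hσu : inner 𝕜 (C.d k σ) (u : W (k + 1)) = ((‖(σ : W k)‖ ^ 2 : ℝ) : 𝕜) := by
      rw [← inner_conj_symm, ← sub_eq_zero.1 (h1 σ), inner_self_eq_norm_sq_to_K]
      simp
    have h := h2 u
    rw [hpu, hσu, inner_zero_left, add_zero, inner_self_eq_norm_sq_to_K] at h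
    have h' : ‖(σ : W k)‖ ^ 2 + ‖C.d (k + 1) u‖ ^ 2 = 0 := by exact_mod_cast h
    have : ‖C.d (k + 1) u‖ = 0 := by nlinarith [sq_nonneg ‖(σ : W k)‖, norm_nonneg (C.d (k + 1) u)]
    exact norm_eq_zero.1 this
  have hσ : (σ : W k) = 0 := by
    have hpu : inner 𝕜 (p : W (k + 1)) (u : W (k + 1)) = 0 := inner_eq_zero_symm.1 (h3 p)
    have h := h2 u
    rw [hpu, hu, inner_zero_left, inner_zero_left, add_zero, add_zero] at h
    have h' := h1 σ
    rw [inner_eq_zero_symm.1 h, sub_zero] at h'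
    exact inner_self_eq_zero.1 h'
  have huB : (u : W (k + 1)) ∈ (C.coboundaries k)ᗮ := by
    rintro _ ⟨τ, rfl⟩
    have h := h1 τ
    rw [hσ, inner_zero_left, zero_sub, neg_eq_zero] at h
    exact inner_eq_zero_symm.1 h
  exact inner_self_eq_zero.1 (h3 ⟨u, C.mem_cocycles.2 ⟨u.2, hu⟩, huB⟩)

theorem IsMixedSolution.sub {f f' : W (k + 1)} {σ σ' : (C.d k).domain}
    {u u' : (C.d (k + 1)).domain} {p p' : C.harmonic k} (h : C.IsMixedSolution k f σ u p)
    (h' : C.IsMixedSolution k f' σ' u' p') :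
    C.IsMixedSolution k (f - f') (σ - σ') (u - u') (p - p') := by
  refine ⟨fun τ => ?_, fun v => ?_, fun q => ?_⟩
  · have e : ∀ a b c d : 𝕜, a - b - (c - d) = (a - c) - (b - d) := fun a b c d => by ring
    rw [Submodule.coe_sub, Submodule.coe_sub, inner_sub_left, inner_sub_left, e, h.1 τ, h'.1 τ,
      sub_self]
  · rw [LinearPMap.map_sub, LinearPMap.map_sub, Submodule.coe_sub, inner_sub_left, inner_sub_left,
      inner_sub_left, inner_sub_left, ← h.2.1 v, ← h'.2.1 v]
    ring
  · rw [Submodule.coe_sub, inner_sub_left, h.2.2 q, h'.2.2 q, sub_self]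

variable {T : W (k + 1) →L[𝕜] W k} {S : W (k + 1 + 1) →L[𝕜] W (k + 1)}

/-- The solution follows the Hodge decomposition of f: T*T f lies in 𝔅 and S S* f in ℨ^⊥, with σ = T
f and du = S* f. The equations hold because τ - T dτ and v - S dv are cocycles. -/
theorem IsPartialInverse.isMixedSolution (hC : C.IsClosedComplex) (hT : C.IsPartialInverse k T)
    (hS : C.IsPartialInverse (k + 1) S) (f : W (k + 1)) :
    ∃ (σ : (C.d k).domain)
      (hu : adjoint T (T f) + S (adjoint S f) ∈ (C.d (k + 1)).domain) (p : C.harmonic k),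
      C.IsMixedSolution k f σ ⟨adjoint T (T f) + S (adjoint S f), hu⟩ p := by
  have hB := hT.adjoint_mem (hC k) (T f)
  have hB' := hS.adjoint_mem (hC (k + 1)) f
  obtain ⟨hZ, hZ0⟩ := C.mem_cocycles.1 (C.coboundaries_le_cocycles k hB)
  have hu := add_mem hZ (hS.mem_domain (adjoint S f))
  have hdu : C.d (k + 1) ⟨adjoint T (T f) + S (adjoint S f), hu⟩ = adjoint S f := by
    have e : C.d (k + 1) ⟨adjoint T (T f) + S (adjoint S f), hu⟩
        = C.d (k + 1) ⟨adjoint T (T f), hZ⟩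
          + C.d (k + 1) ⟨S (adjoint S f), hS.mem_domain (adjoint S f)⟩ :=
      (C.d (k + 1)).map_add ⟨_, hZ⟩ ⟨_, hS.mem_domain (adjoint S f)⟩
    rw [e, hZ0, zero_add, hS.d_apply hB']
  set σ : (C.d k).domain := ⟨T f, hT.mem_domain f⟩ with hσ
  -- The harmonic part of f: its cocycle component minus its coboundary component dσ.
  have hpZ : (C.cocycles (k + 1)).starProjection f - C.d k σ ∈ C.cocycles (k + 1) :=
    sub_mem (Submodule.starProjection_apply_mem _ _)
      (C.coboundaries_le_cocycles k (C.d_mem_coboundaries σ))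
  have hpB : (C.cocycles (k + 1)).starProjection f - C.d k σ ∈ (C.coboundaries k)ᗮ := by
    have h := sub_mem (hT.sub_d_mem f) (Submodule.orthogonal_le (C.coboundaries_le_cocycles k)
      (Submodule.sub_starProjection_mem_orthogonal (K := C.cocycles (k + 1)) f))
    rwa [sub_sub_sub_cancel_left] at h
  refine ⟨σ, hu, ⟨_, hpZ, hpB⟩, fun τ => ?_, fun v => ?_, fun q => ?_⟩
  · have h1 : inner 𝕜 (S (adjoint S f)) (C.d k τ) = 0 :=
      (Submodule.mem_orthogonal' _ _).1 (hS.mem_orthogonal _) _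
        (C.coboundaries_le_cocycles k (C.d_mem_coboundaries τ))
    have h2 : inner 𝕜 (T f) ((τ : W k) - T (C.d k τ)) = 0 :=
      (Submodule.mem_orthogonal' _ _).1 (hT.mem_orthogonal _) _ (hT.sub_apply_d_mem τ)
    rw [inner_add_left, h1, ContinuousLinearMap.adjoint_inner_left, add_zero, ← inner_sub_right, h2]
  · have h1 : inner 𝕜 ((C.cocycles (k + 1)).starProjection f)
        (S (C.d (k + 1) v)) = 0 :=
      hS.mem_orthogonal _ _ (Submodule.starProjection_apply_mem _ _)
    have h2 : inner 𝕜 (f - (C.cocycles (k + 1)).starProjection f)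
        ((v : W (k + 1)) - S (C.d (k + 1) v)) = 0 :=
      (Submodule.mem_orthogonal' _ _).1 (Submodule.sub_starProjection_mem_orthogonal f) _
        (hS.sub_apply_d_mem v)
    rw [inner_sub_left, inner_sub_right, inner_sub_right, h1] at h2
    rw [hdu, ContinuousLinearMap.adjoint_inner_left, inner_sub_left]
    linear_combination -h2
  · have h1 : inner 𝕜 (S (adjoint S f)) (q : W (k + 1)) = 0 :=
      (Submodule.mem_orthogonal' _ _).1 (hS.mem_orthogonal _) _ q.2.1
    have h2 : inner 𝕜 (adjoint T (T f)) (q : W (k + 1)) = 0 := q.2.2 _ hB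
    rw [inner_add_left, h1, h2, add_zero]

/-- The solution operator in terms of the partial inverses of the two differentials. -/
theorem IsPartialInverse.isSolutionOperator (hC : C.IsClosedComplex) (hT : C.IsPartialInverse k T)
    (hS : C.IsPartialInverse (k + 1) S) :
    C.IsSolutionOperator k (adjoint T ∘L T + S ∘L adjoint S) := by
  intro f u
  obtain ⟨σ, hu, p, h⟩ := hT.isMixedSolution hC hS f
  constructor
  · rintro rfl
    exact ⟨σ, hu, p, h⟩
  · rintro ⟨σ', hu', p', h'⟩
    have h0 := h.sub h'
    rw [sub_self] at h0
    exact sub_eq_zero.1 h0.eq_zero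

end SolutionOperator

end HilbertComplex

/-! ### From pointwise to norm convergence by compactness. -/

section CompactComposition

variable {𝕜 ι G E E' : Type*} [RCLike 𝕜] [NormedAddCommGroup G] [NormedSpace 𝕜 G]
  [NormedAddCommGroup E] [NormedSpace 𝕜 E] [NormedAddCommGroup E'] [NormedSpace 𝕜 E']

/-- A bounded family of operators that tends to zero pointwise on the range of a compact operator
tends to zero in norm after composition with the compact operator. -/
theorem tendsto_norm_comp_of_isCompactOperator {l : Filter ι} {A : G →L[𝕜] E}
    (hA : IsCompactOperator A) {X : ι → E →L[𝕜] E'} {c : ℝ} (hX : ∀ h, ‖X h‖ ≤ c)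
    (hlim : ∀ x, Tendsto (fun h => ‖X h (A x)‖) l (𝓝 0)) :
    Tendsto (fun h => ‖X h ∘L A‖) l (𝓝 0) := by
  rw [Metric.tendsto_nhds]
  intro ε hε
  obtain ⟨Q, hQ, hsub⟩ :=
    IsCompactOperator.image_closedBall_subset_compact (f := (A : G →ₗ[𝕜] E)) hA 1
  -- The radius of the finite net in the image of the unit ball: `X h` enlarges an error of this
  -- size to at most ε / 4, and another ε / 4 is spent on the net points.
  have hδ : 0 < ε / 4 / (|c| + 1) := by positivity
  obtain ⟨t, ht, htfin, hcov⟩ :=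
    Metric.finite_approx_of_totallyBounded (hQ.totallyBounded.subset hsub) _ hδ
  have hev : ∀ᶠ h in l, ∀ y ∈ t, ‖X h y‖ < ε / 4 := by
    rw [eventually_all_finite htfin]
    intro y hy
    obtain ⟨x, -, rfl⟩ := ht hy
    exact (hlim x).eventually_lt_const (by positivity)
  filter_upwards [hev] with h hh
  rw [Real.dist_0_eq_abs, abs_of_nonneg (norm_nonneg _)]
  have hball : ∀ x ∈ Metric.closedBall (0 : G) 1, ‖X h (A x)‖ ≤ ε / 2 := fun x hx => by
    obtain ⟨y, hy, hxy⟩ := Set.mem_iUnion₂.1 (hcov (Set.mem_image_of_mem _ hx))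
    rw [Metric.mem_ball, dist_eq_norm] at hxy
    have hxy' : ‖A x - y‖ < ε / 4 / (|c| + 1) := hxy
    have h1 : ‖X h (A x - y)‖ ≤ (|c| + 1) * (ε / 4 / (|c| + 1)) :=
      ((X h).le_opNorm _).trans (mul_le_mul
        (((hX h).trans (le_abs_self c)).trans (by linarith)) hxy'.le (norm_nonneg _)
        (by positivity))
    rw [mul_div_cancel₀ _ (by positivity)] at h1
    calc ‖X h (A x)‖ = ‖X h (A x - y) + X h y‖ := by rw [← map_add, sub_add_cancel]
      _ ≤ ‖X h (A x - y)‖ + ‖X h y‖ := norm_add_le _ _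
      _ ≤ ε / 2 := by linarith [hh y hy]
  refine lt_of_le_of_lt ?_ (half_lt_self hε)
  refine ContinuousLinearMap.opNorm_le_bound _ (by positivity) fun x => ?_
  by_cases hx : x = 0
  · simp [hx]
  have hx' : (‖x‖ : 𝕜) ≠ 0 := by simpa using hx
  have := hball ((‖x‖ : 𝕜)⁻¹ • x) (by
    rw [mem_closedBall_zero_iff, norm_smul, norm_inv, RCLike.norm_ofReal, abs_norm,
      inv_mul_cancel₀ (norm_ne_zero_iff.2 hx)])
  rw [map_smul, map_smul, norm_smul, norm_inv, RCLike.norm_ofReal, abs_norm,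
    inv_mul_le_iff₀ (norm_pos_iff.2 hx)] at this
  rwa [mul_comm] at this

end CompactComposition

namespace HilbertComplex

/-! ### Morphisms and partial inverses of retracts. -/

section Morphism

variable {𝕜 : Type*} [RCLike 𝕜]
  {W : ℤ → Type*} [∀ k, NormedAddCommGroup (W k)] [∀ k, InnerProductSpace 𝕜 (W k)]
  [∀ k, CompleteSpace (W k)]
  {W' : ℤ → Type*} [∀ k, NormedAddCommGroup (W' k)] [∀ k, InnerProductSpace 𝕜 (W' k)]
  [∀ k, CompleteSpace (W' k)] {C : HilbertComplex 𝕜 W} {D : HilbertComplex 𝕜 W'}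

theorem Morphism.map_mem_coboundaries (f : Morphism C D) {k : ℤ} {g : W (k + 1)}
    (hg : g ∈ C.coboundaries k) : f.toMap (k + 1) g ∈ D.coboundaries k := by
  obtain ⟨v, rfl⟩ := hg
  exact ⟨⟨_, f.map_mem k v⟩, f.comm k v⟩

theorem Morphism.map_mem_cocycles (f : Morphism C D) {k : ℤ} {u : W k}
    (hu : u ∈ C.cocycles k) : f.toMap k u ∈ D.cocycles k := by
  obtain ⟨hu, h⟩ := C.mem_cocycles.1 hu
  refine D.mem_cocycles.2 ⟨f.map_mem k ⟨u, hu⟩, ?_⟩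
  rw [f.comm k ⟨u, hu⟩, h, map_zero]

/-- The partial inverse of a differential of a retract, in terms of that of the ambient complex. -/
theorem IsPartialInverse.eq_of_retraction {k : ℤ} {T : W (k + 1) →L[𝕜] W k}
    (hT : C.IsPartialInverse k T) {T' : W' (k + 1) →L[𝕜] W' k} (hT' : D.IsPartialInverse k T')
    (i : Morphism D C) (π : Morphism C D)
    (hπi : ∀ k (w : W' k), π.toMap k (i.toMap k w) = w)
    [(D.coboundaries k).HasOrthogonalProjection] :
    T' = (D.cocycles k)ᗮ.starProjection ∘L π.toMap k ∘L T ∘L i.toMap (k + 1)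
      ∘L (D.coboundaries k).starProjection := by
  ext g
  set b := (D.coboundaries k).starProjection g with hb
  have hbB : b ∈ D.coboundaries k := Submodule.starProjection_apply_mem _ _
  set z : (C.d k).domain := ⟨T (i.toMap (k + 1) b), hT.mem_domain _⟩ with hz
  have hdz : C.d k z = i.toMap (k + 1) b := hT.d_apply (i.map_mem_coboundaries hbB)
  -- Since π commutes with the differentials and π i = id, y is a preimage of b; removing its
  -- cocycle part gives the preimage of minimal norm.
  set y : W' k := π.toMap k z with hy
  have hyd : y ∈ (D.d k).domain := π.map_mem k z
  have hdy : D.d k ⟨y, hyd⟩ = b := by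
    rw [π.comm k z, hdz, hπi]
  have hsub : y - (D.cocycles k)ᗮ.starProjection y ∈ D.cocycles k :=
    Submodule.sub_starProjection_orthogonal_mem _ _
  obtain ⟨hs, hs0⟩ := D.mem_cocycles.1 hsub
  have hmem : (D.cocycles k)ᗮ.starProjection y ∈ (D.d k).domain := by
    have := sub_mem hyd hs
    rwa [sub_sub_cancel] at this
  change T' g = (D.cocycles k)ᗮ.starProjection y
  refine hT'.eq_apply (z := ⟨_, hmem⟩) ?_ (Submodule.starProjection_apply_mem _ _)
  have e : D.d k ⟨_, hmem⟩ = b := by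
    have e1 : D.d k ⟨y, hyd⟩ - D.d k ⟨_, hmem⟩ = 0 := by
      rw [← LinearPMap.map_sub]
      exact hs0
    rw [← sub_eq_zero.1 e1, hdy]
  rw [e]
  exact Submodule.sub_starProjection_mem_orthogonal _

end Morphism

/-- A family of Hilbert complexes that are retracts of a given one by uniformly bounded morphisms
and approximate it. -/
structure IsApproximation {𝕜 : Type*} [RCLike 𝕜]
    {W : ℤ → Type*} [∀ k, NormedAddCommGroup (W k)] [∀ k, InnerProductSpace 𝕜 (W k)]
    [∀ k, CompleteSpace (W k)] (C : HilbertComplex 𝕜 W) {ι : Type*} (l : Filter ι)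
    {Wh : ι → ℤ → Type*} [∀ h k, NormedAddCommGroup (Wh h k)]
    [∀ h k, InnerProductSpace 𝕜 (Wh h k)] [∀ h k, CompleteSpace (Wh h k)]
    (Ch : ∀ h, HilbertComplex 𝕜 (Wh h)) (i : ∀ h, Morphism (Ch h) C)
    (π : ∀ h, Morphism C (Ch h)) : Prop where
  closed : C.IsClosedComplex
  closed_discrete : ∀ h, (Ch h).IsClosedComplex
  compactness : C.CompactnessProperty
  retraction : ∀ h k (w : Wh h k), (π h).toMap k ((i h).toMap k w) = w
  embed_bdd : ∀ k, ∃ c : ℝ, ∀ h, ‖(i h).toMap k‖ ≤ c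
  proj_bdd : ∀ k, ∃ c : ℝ, ∀ h, ‖(π h).toMap k‖ ≤ c
  approx : ∀ k, ∀ v ∈ (C.d k).domain, Tendsto
    (fun h => Metric.infDist v ((i h).toMap k '' ((Ch h).d k).domain)) l (𝓝 0)
  gram : ∀ k, Tendsto (fun h => ‖ContinuousLinearMap.id 𝕜 (Wh h k)
    - (adjoint ((i h).toMap k)) ∘L ((i h).toMap k)‖) l (𝓝 0)

/-! ### Pointwise convergence of the embeddings and projections. -/

namespace IsApproximation

variable {𝕜 : Type*} [RCLike 𝕜]
    {W : ℤ → Type*} [∀ k, NormedAddCommGroup (W k)] [∀ k, InnerProductSpace 𝕜 (W k)]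
    [∀ k, CompleteSpace (W k)] {C : HilbertComplex 𝕜 W} {ι : Type*} {l : Filter ι}
    {Wh : ι → ℤ → Type*} [∀ h k, NormedAddCommGroup (Wh h k)]
    [∀ h k, InnerProductSpace 𝕜 (Wh h k)] [∀ h k, CompleteSpace (Wh h k)]
    {Ch : ∀ h, HilbertComplex 𝕜 (Wh h)} {i : ∀ h, Morphism (Ch h) C}
    {π : ∀ h, Morphism C (Ch h)}

theorem exists_bound (H : IsApproximation C l Ch i π) (k : ℤ) :
    ∃ c : ℝ, 0 ≤ c ∧ (∀ h, ‖(i h).toMap k‖ ≤ c) ∧ ∀ h, ‖(π h).toMap k‖ ≤ c := by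
  obtain ⟨a, ha⟩ := H.embed_bdd k
  obtain ⟨b, hb⟩ := H.proj_bdd k
  exact ⟨max (max a b) 0, le_max_right _ _,
    fun h => (ha h).trans ((le_max_left a b).trans (le_max_left _ _)),
    fun h => (hb h).trans ((le_max_right a b).trans (le_max_left _ _))⟩

/-- I - iπ annihilates the range of i, so on the domain of `d k` its values are at most 1 + c² times
the distance to the discrete domain. Density and the uniform bound extend the limit to all x. -/
theorem tendsto_embed_proj (H : IsApproximation C l Ch i π) (k : ℤ) (x : W k) :
    Tendsto (fun h => ‖x - (i h).toMap k ((π h).toMap k x)‖) l (𝓝 0) := by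
  obtain ⟨c, hc, hi, hπ⟩ := H.exists_bound k
  have hbound : ∀ h (y : W k), ‖y - (i h).toMap k ((π h).toMap k y)‖ ≤ (1 + c * c) * ‖y‖ :=
    fun h y => by
      have h1 : ‖(i h).toMap k ((π h).toMap k y)‖ ≤ c * (c * ‖y‖) :=
        ((i h).toMap k).le_of_opNorm_le_of_le (hi h) (((π h).toMap k).le_of_opNorm_le (hπ h) y)
      calc _ ≤ ‖y‖ + ‖(i h).toMap k ((π h).toMap k y)‖ := norm_sub_le _ _
        _ ≤ _ := by linarith
  have hpos : 0 < 1 + c * c := by positivity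
  have hdom : ∀ v ∈ (C.d k).domain,
      Tendsto (fun h => ‖v - (i h).toMap k ((π h).toMap k v)‖) l (𝓝 0) := fun v hv => by
    have h0 := (H.approx k v hv).const_mul (1 + c * c)
    rw [mul_zero] at h0
    refine squeeze_zero (fun _ => norm_nonneg _) (fun h => ?_) h0
    rw [← div_le_iff₀' hpos]
    refine (Metric.le_infDist (Set.Nonempty.image _ ⟨0, zero_mem _⟩)).2 ?_
    rintro _ ⟨w, -, rfl⟩
    rw [div_le_iff₀' hpos, dist_eq_norm]
    refine le_trans (le_of_eq ?_) (hbound h _)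
    rw [map_sub, map_sub, H.retraction, sub_sub_sub_cancel_right]
  rw [Metric.tendsto_nhds]
  intro ε hε
  obtain ⟨v, hv, hxv⟩ := Metric.mem_closure_iff.1 (C.dense_domain k x) (ε / 2 / (1 + c * c))
    (by positivity)
  filter_upwards [(hdom v hv).eventually_lt_const (half_pos hε)] with h hh
  rw [Real.dist_0_eq_abs, abs_norm]
  have h1 := hbound h (x - v)
  rw [dist_eq_norm, lt_div_iff₀' hpos] at hxv
  have e : x - (i h).toMap k ((π h).toMap k x)
      = (x - v - (i h).toMap k ((π h).toMap k (x - v)))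
        + (v - (i h).toMap k ((π h).toMap k v)) := by
    rw [map_sub, map_sub]
    abel
  rw [e]
  exact (norm_add_le _ _).trans_lt (by linarith)

/-- i* x - π x = i* (x - iπx) - (I - i* i) π x. This allows π, which commutes with d, and i*, which
respects orthogonality, to replace each other. -/
theorem tendsto_adjoint_sub_proj (H : IsApproximation C l Ch i π) (k : ℤ) (x : W k) :
    Tendsto (fun h => ‖adjoint ((i h).toMap k) x - (π h).toMap k x‖) l (𝓝 0) := by
  obtain ⟨c, hc, hi, hπ⟩ := H.exists_bound k
  have h0 := ((H.tendsto_embed_proj k x).const_mul c).add ((H.gram k).mul_const (c * ‖x‖))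
  simp only [zero_mul, mul_zero, add_zero] at h0
  refine squeeze_zero (fun _ => norm_nonneg _) (fun h => ?_) h0
  have e : adjoint ((i h).toMap k) x - (π h).toMap k x
      = adjoint ((i h).toMap k) (x - (i h).toMap k ((π h).toMap k x))
        - (ContinuousLinearMap.id 𝕜 (Wh h k) - adjoint ((i h).toMap k) ∘L (i h).toMap k)
          ((π h).toMap k x) := by
    simp
  rw [e]
  refine (norm_sub_le _ _).trans (add_le_add ?_ ?_)
  · refine ContinuousLinearMap.le_of_opNorm_le _ ?_ _
    rw [LinearIsometryEquiv.norm_map]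
    exact hi h
  · exact ContinuousLinearMap.le_opNorm_of_le _ (((π h).toMap k).le_of_opNorm_le (hπ h) x)

theorem tendsto_embed_adjoint (H : IsApproximation C l Ch i π) (k : ℤ) (x : W k) :
    Tendsto (fun h => ‖x - (i h).toMap k (adjoint ((i h).toMap k) x)‖) l (𝓝 0) := by
  obtain ⟨c, hc, hi, hπ⟩ := H.exists_bound k
  have h0 := (H.tendsto_embed_proj k x).add ((H.tendsto_adjoint_sub_proj k x).const_mul c)
  simp only [mul_zero, add_zero] at h0
  refine squeeze_zero (fun _ => norm_nonneg _) (fun h => ?_) h0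
  have e : x - (i h).toMap k (adjoint ((i h).toMap k) x)
      = (x - (i h).toMap k ((π h).toMap k x))
        - (i h).toMap k (adjoint ((i h).toMap k) x - (π h).toMap k x) := by
    rw [map_sub]
    abel
  rw [e]
  exact (norm_sub_le _ _).trans
    (add_le_add_right (((i h).toMap k).le_of_opNorm_le (hi h) _) _)

/-! ### Norm convergence of the partial inverses. -/

section PartialInverse

variable {k : ℤ} {T : W (k + 1) →L[𝕜] W k} {Th : ∀ h, Wh h (k + 1) →L[𝕜] Wh h k}

/-- As i maps cocycles to cocycles, i* z is orthogonal to the discrete cocycles; the projection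
therefore changes π z only by a part of π z - i* z. -/
theorem tendsto_cocycles_orthogonal (H : IsApproximation C l Ch i π) {z : W k}
    (hz : z ∈ (C.cocycles k)ᗮ) :
    Tendsto (fun h => ‖z - (i h).toMap k (((Ch h).cocycles k)ᗮ.starProjection
      ((π h).toMap k z))‖) l (𝓝 0) := by
  obtain ⟨c, hc, hi, hπ⟩ := H.exists_bound k
  have h0 := (H.tendsto_embed_proj k z).add ((H.tendsto_adjoint_sub_proj k z).const_mul c)
  simp only [mul_zero, add_zero] at h0
  refine squeeze_zero (fun _ => norm_nonneg _) (fun h => ?_) h0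
  set P := ((Ch h).cocycles k).starProjection
  have hP : P (adjoint ((i h).toMap k) z) = 0 := by
    refine (Submodule.starProjection_apply_eq_zero_iff _).2 fun y hy => ?_
    rw [ContinuousLinearMap.adjoint_inner_right]
    exact hz _ ((i h).map_mem_cocycles hy)
  have e : z - (i h).toMap k (((Ch h).cocycles k)ᗮ.starProjection ((π h).toMap k z))
      = (z - (i h).toMap k ((π h).toMap k z))
        - (i h).toMap k (P (adjoint ((i h).toMap k) z - (π h).toMap k z)) := by
    rw [map_sub P, hP, zero_sub, Submodule.starProjection_orthogonal_val, map_sub, map_neg]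
    abel
  rw [e]
  exact (norm_sub_le _ _).trans (add_le_add_right (((i h).toMap k).le_of_opNorm_le_of_le (hi h)
    (Submodule.norm_starProjection_apply_le _ _)) _)

/-- Here π is the good map: π b is a discrete coboundary, fixed by the projection, and i* b is close
to it. -/
theorem tendsto_coboundaries (H : IsApproximation C l Ch i π)
    [∀ h, ((Ch h).coboundaries k).HasOrthogonalProjection] {b : W (k + 1)}
    (hb : b ∈ C.coboundaries k) :
    Tendsto (fun h => ‖(i h).toMap (k + 1) (((Ch h).coboundaries k).starProjection
      (adjoint ((i h).toMap (k + 1)) b)) - b‖) l (𝓝 0) := by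
  obtain ⟨c, hc, hi, hπ⟩ := H.exists_bound (k + 1)
  have h0 := ((H.tendsto_adjoint_sub_proj (k + 1) b).const_mul c).add
    (H.tendsto_embed_proj (k + 1) b)
  simp only [mul_zero, add_zero] at h0
  refine squeeze_zero (fun _ => norm_nonneg _) (fun h => ?_) h0
  set P := ((Ch h).coboundaries k).starProjection
  have hP : P ((π h).toMap (k + 1) b) = (π h).toMap (k + 1) b :=
    Submodule.starProjection_eq_self_iff.2 ((π h).map_mem_coboundaries hb)
  have e : (i h).toMap (k + 1) (P (adjoint ((i h).toMap (k + 1)) b)) - b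
      = (i h).toMap (k + 1) (P (adjoint ((i h).toMap (k + 1)) b - (π h).toMap (k + 1) b))
        - (b - (i h).toMap (k + 1) ((π h).toMap (k + 1) b)) := by
    rw [map_sub P, hP, map_sub]
    abel
  rw [e]
  exact (norm_sub_le _ _).trans (add_le_add_left (((i h).toMap (k + 1)).le_of_opNorm_le_of_le
    (hi h) (Submodule.norm_starProjection_apply_le _ _)) _)

/-- A uniform discrete Poincaré inequality, read off from the factorization through T. -/
theorem exists_bound_partialInverse (H : IsApproximation C l Ch i π)
    (hT : C.IsPartialInverse k T) (hTh : ∀ h, (Ch h).IsPartialInverse k (Th h)) :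
    ∃ c : ℝ, 0 ≤ c ∧ ∀ h, ‖Th h‖ ≤ c := by
  obtain ⟨c, hc, -, hπ⟩ := H.exists_bound k
  obtain ⟨c', hc', hi, -⟩ := H.exists_bound (k + 1)
  refine ⟨c * (‖T‖ * c'), by positivity, fun h => ?_⟩
  have : CompleteSpace ((Ch h).coboundaries k) := (H.closed_discrete h k).completeSpace_coe
  refine ContinuousLinearMap.opNorm_le_bound _ (by positivity) fun g => ?_
  rw [hT.eq_of_retraction (hTh h) (i h) (π h) (H.retraction h)]
  simp only [ContinuousLinearMap.comp_apply]
  refine (Submodule.norm_starProjection_apply_le _ _).trans ?_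
  rw [mul_assoc, mul_assoc]
  exact ContinuousLinearMap.le_of_opNorm_le_of_le _ (hπ h) (T.le_opNorm_of_le
    (ContinuousLinearMap.le_of_opNorm_le_of_le _ (hi h)
      (Submodule.norm_starProjection_apply_le _ _)))

theorem isCompactOperator_partialInverse (H : IsApproximation C l Ch i π)
    (hT : C.IsPartialInverse k T) (hTh : ∀ h, (Ch h).IsPartialInverse k (Th h)) (h : ι) :
    IsCompactOperator (Th h) := by
  have : CompleteSpace ((Ch h).coboundaries k) := (H.closed_discrete h k).completeSpace_coe
  rw [hT.eq_of_retraction (hTh h) (i h) (π h) (H.retraction h)]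
  exact (((hT.isCompactOperator (H.closed k) H.compactness).comp_clm
    ((i h).toMap (k + 1) ∘L ((Ch h).coboundaries k).starProjection)).clm_comp
      ((π h).toMap k)).clm_comp ((Ch h).cocycles k)ᗮ.starProjection

/-- The partial inverses of the differentials converge in norm. -/
theorem tendsto_partialInverse (H : IsApproximation C l Ch i π)
    (hT : C.IsPartialInverse k T) (hTh : ∀ h, (Ch h).IsPartialInverse k (Th h)) :
    Tendsto (fun h => (i h).toMap k ∘L Th h ∘L adjoint ((i h).toMap (k + 1))) l (𝓝 T) := by
  have hcomplete : ∀ h, CompleteSpace ((Ch h).coboundaries k) := fun h =>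
    (H.closed_discrete h k).completeSpace_coe
  have hTc := hT.isCompactOperator (H.closed k) H.compactness
  obtain ⟨c, hc, hi, hπ⟩ := H.exists_bound k
  obtain ⟨c', hc', hi', -⟩ := H.exists_bound (k + 1)
  set X : ι → W k →L[𝕜] W k := fun h =>
    (i h).toMap k ∘L ((Ch h).cocycles k)ᗮ.starProjection ∘L (π h).toMap k with hX
  set Y : ι → W (k + 1) →L[𝕜] W (k + 1) := fun h =>
    (i h).toMap (k + 1) ∘L ((Ch h).coboundaries k).starProjection
      ∘L adjoint ((i h).toMap (k + 1)) - ContinuousLinearMap.id 𝕜 _ with hY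
  have hXb : ∀ h, ‖X h‖ ≤ c * c := fun h =>
    ContinuousLinearMap.opNorm_le_bound _ (by positivity) fun x => by
      rw [mul_assoc]
      exact ((i h).toMap k).le_of_opNorm_le_of_le (hi h)
        ((Submodule.norm_starProjection_apply_le _ _).trans
          (ContinuousLinearMap.le_of_opNorm_le _ (hπ h) x))
  have hYb : ∀ h, ‖Y h‖ ≤ c' * c' + 1 := fun h => by
    refine (norm_sub_le _ _).trans (add_le_add ?_ ContinuousLinearMap.norm_id_le)
    refine ContinuousLinearMap.opNorm_le_bound _ (by positivity) fun x => ?_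
    rw [mul_assoc]
    refine ((i h).toMap (k + 1)).le_of_opNorm_le_of_le (hi' h)
      ((Submodule.norm_starProjection_apply_le _ _).trans
        (ContinuousLinearMap.le_of_opNorm_le _ ?_ x))
    rw [LinearIsometryEquiv.norm_map]
    exact hi' h
  have hX0 : Tendsto (fun h => ‖(ContinuousLinearMap.id 𝕜 (W k) - X h) ∘L T‖) l (𝓝 0) :=
    tendsto_norm_comp_of_isCompactOperator hTc (c := 1 + c * c)
      (fun h => (norm_sub_le _ _).trans (add_le_add ContinuousLinearMap.norm_id_le (hXb h)))
      fun x => H.tendsto_cocycles_orthogonal (hT.mem_orthogonal x)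
  have hY0 : Tendsto (fun h => ‖Y h ∘L adjoint T ∘L T‖) l (𝓝 0) :=
    tendsto_norm_comp_of_isCompactOperator (A := adjoint T ∘L T) (hTc.clm_comp (adjoint T)) hYb
      fun x => H.tendsto_coboundaries (hT.adjoint_mem (H.closed k) (T x))
  have hYadj : ∀ h, adjoint (Y h) = Y h := fun h => by
    simp only [hY, map_sub, ContinuousLinearMap.adjoint_comp, ContinuousLinearMap.adjoint_adjoint,
      ContinuousLinearMap.adjoint_id]
    rw [(isSelfAdjoint_starProjection _).adjoint_eq, ContinuousLinearMap.comp_assoc]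
  -- As Y is self-adjoint, ‖T Y‖² = ‖Y T*T Y‖ ≤ ‖Y T*T‖ ‖Y‖; this way compactness of T suffices and
  -- that of T* is not needed.
  have hTY : Tendsto (fun h => ‖T ∘L Y h‖) l (𝓝 0) := by
    have h0 := (hY0.mul_const (c' * c' + 1)).sqrt
    rw [zero_mul, Real.sqrt_zero] at h0
    refine squeeze_zero (fun _ => norm_nonneg _) (fun h => Real.le_sqrt_of_sq_le ?_) h0
    rw [sq, ← ContinuousLinearMap.norm_adjoint_comp_self, ContinuousLinearMap.adjoint_comp, hYadj]
    refine le_trans (ContinuousLinearMap.opNorm_comp_le (Y h ∘L adjoint T ∘L T) (Y h)) ?_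
    gcongr
    exact hYb h
  rw [tendsto_iff_norm_sub_tendsto_zero]
  have h0 := (hTY.const_mul (c * c)).add hX0
  rw [mul_zero, add_zero] at h0
  refine squeeze_zero (fun _ => norm_nonneg _) (fun h => ?_) h0
  have e : (i h).toMap k ∘L Th h ∘L adjoint ((i h).toMap (k + 1)) - T
      = X h ∘L (T ∘L Y h) - (ContinuousLinearMap.id 𝕜 (W k) - X h) ∘L T := by
    rw [hT.eq_of_retraction (hTh h) (i h) (π h) (H.retraction h)]
    ext x
    simp [hX, hY]
  rw [e]
  refine (norm_sub_le _ _).trans (add_le_add_left ?_ _)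
  exact (ContinuousLinearMap.opNorm_comp_le _ _).trans (by gcongr; exact hXb h)

end PartialInverse

end IsApproximation

end HilbertComplex

/-- With P the projection onto the range of i, i* = i* P and iπ is the identity on that range, so πP
- i* = (I - i* i) πP. -/
theorem norm_sub_comp_pulledBackProjection_le {𝕜 E F : Type*} [RCLike 𝕜]
    [NormedAddCommGroup E] [InnerProductSpace 𝕜 E] [CompleteSpace E]
    [NormedAddCommGroup F] [InnerProductSpace 𝕜 F] [CompleteSpace F]
    (i : F →L[𝕜] E) (π : E →L[𝕜] F) (hπi : ∀ w, π (i w) = w) :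
    ‖pulledBackProjection i π - adjoint i‖
      ≤ ‖ContinuousLinearMap.id 𝕜 F - adjoint i ∘L i‖ * ‖π‖ := by
  set R := (LinearMap.range (i : F →ₗ[𝕜] E)).topologicalClosure with hR
  have hiπ : ∀ x ∈ R, i (π x) = x := fun x hx => by
    have hx' : x ∈ closure (Set.range i) := by
      rwa [← SetLike.mem_coe, hR, Submodule.topologicalClosure_coe] at hx
    refine closure_minimal (t := {x | i (π x) = x}) ?_
      (isClosed_eq (by fun_prop) continuous_id) hx'
    rintro _ ⟨w, rfl⟩
    exact congrArg i (hπi w)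
  have hadj : ∀ x, adjoint i (R.starProjection x) = adjoint i x := fun x => by
    rw [← sub_eq_zero, ← map_sub, ← inner_self_eq_zero (𝕜 := 𝕜),
      ContinuousLinearMap.adjoint_inner_left, ← neg_sub, inner_neg_left, neg_eq_zero]
    exact (Submodule.mem_orthogonal' _ _).1 (Submodule.sub_starProjection_mem_orthogonal x) _
      (Submodule.le_topologicalClosure _ ⟨_, rfl⟩)
  refine ContinuousLinearMap.opNorm_le_bound _ (by positivity) fun x => ?_
  have e : (pulledBackProjection i π - adjoint i) x
      = (ContinuousLinearMap.id 𝕜 F - adjoint i ∘L i) (π (R.starProjection x)) := by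
    change π (R.starProjection x) - adjoint i x = _
    simp only [sub_apply, ContinuousLinearMap.id_apply, ContinuousLinearMap.comp_apply]
    rw [hiπ _ (Submodule.starProjection_apply_mem _ _), hadj]
  rw [e, mul_assoc]
  exact ContinuousLinearMap.le_opNorm_of_le _
    (π.le_opNorm_of_le (Submodule.norm_starProjection_apply_le _ _))

theorem Filter.Tendsto.clm_comp {𝕜 ι E F G : Type*} [RCLike 𝕜]
    [NormedAddCommGroup E] [NormedSpace 𝕜 E] [NormedAddCommGroup F] [NormedSpace 𝕜 F]
    [NormedAddCommGroup G] [NormedSpace 𝕜 G] {l : Filter ι} {g : ι → F →L[𝕜] G}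
    {f : ι → E →L[𝕜] F} {A : F →L[𝕜] G} {B : E →L[𝕜] F} (hg : Tendsto g l (𝓝 A))
    (hf : Tendsto f l (𝓝 B)) : Tendsto (fun h => g h ∘L f h) l (𝓝 (A ∘L B)) :=
  ((continuous_fst.clm_comp continuous_snd).tendsto (A, B)).comp (hg.prodMk_nhds hf)

/-! ### Operators of the form T*T + SS*. -/

section AdjointProducts

variable {𝕜 E F G : Type*} [RCLike 𝕜]
  [NormedAddCommGroup E] [InnerProductSpace 𝕜 E] [CompleteSpace E]
  [NormedAddCommGroup F] [InnerProductSpace 𝕜 F] [CompleteSpace F]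
  [NormedAddCommGroup G] [InnerProductSpace 𝕜 G] [CompleteSpace G]

theorem isCompactOperator_adjoint_comp_add {T : E →L[𝕜] F} {S : G →L[𝕜] E}
    (hT : IsCompactOperator T) (hS : IsCompactOperator S) :
    IsCompactOperator (adjoint T ∘L T + S ∘L adjoint S) := by
  have h1 : IsCompactOperator (adjoint T ∘L T) := hT.clm_comp (adjoint T)
  have h2 : IsCompactOperator (S ∘L adjoint S) := hS.comp_clm (adjoint S)
  exact h1.add h2

theorem isPositive_adjoint_comp_add (T : E →L[𝕜] F) (S : G →L[𝕜] E) :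
    (adjoint T ∘L T + S ∘L adjoint S).IsPositive :=
  (ContinuousLinearMap.isPositive_adjoint_comp_self T).add
    (ContinuousLinearMap.isPositive_self_comp_adjoint S)

theorem norm_adjoint_comp_add_le {T : E →L[𝕜] F} {S : G →L[𝕜] E} {c c' : ℝ} (hT : ‖T‖ ≤ c)
    (hS : ‖S‖ ≤ c') : ‖adjoint T ∘L T + S ∘L adjoint S‖ ≤ c * c + c' * c' := by
  refine (norm_add_le _ _).trans (add_le_add ?_ ?_)
  · rw [ContinuousLinearMap.norm_adjoint_comp_self]
    exact mul_self_le_mul_self (norm_nonneg _) hT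
  · refine (ContinuousLinearMap.opNorm_comp_le _ _).trans ?_
    rw [LinearIsometryEquiv.norm_map]
    exact mul_self_le_mul_self (norm_nonneg _) hS

end AdjointProducts

namespace HilbertComplex

/-! ### Eigenvalues as reciprocals of those of the solution operator. -/

section Eigensystem

variable {𝕜 : Type*} [RCLike 𝕜]
  {W : ℤ → Type*} [∀ k, NormedAddCommGroup (W k)] [∀ k, InnerProductSpace 𝕜 (W k)]
  [∀ k, CompleteSpace (W k)] {C : HilbertComplex 𝕜 W} {k : ℤ} {K : W (k + 1) →L[𝕜] W (k + 1)}

/-- In particular t = 0 admits only u = 0: harmonic elements are excluded by the third equation of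
the mixed problem. -/
theorem IsSolutionOperator.solvesEigenproblem_iff (hK : C.IsSolutionOperator k K) {t : 𝕜}
    {u : W (k + 1)} : C.SolvesEigenproblem k t u ↔ t • K u = u := by
  rw [← map_smul]
  exact (hK (t • u) u).symm

theorem IsEigensystem.pos {N : ℕ∞} {lam : ℕ → ℝ} {u : ℕ → W (k + 1)}
    (h : C.IsEigensystem k N lam u) (hK : C.IsSolutionOperator k K) (hpos : K.IsPositive)
    {n : ℕ} (hn : (n : ℕ∞) < N) : 0 < lam n := by
  have h1 := hK.solvesEigenproblem_iff.1 (h.solves n hn)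
  have h2 : ‖u n‖ = 1 := h.orthonormal.1 ⟨n, hn⟩
  have h3 : lam n * RCLike.re (inner 𝕜 (K (u n)) (u n)) = 1 := by
    rw [← RCLike.re_ofReal_mul, ← RCLike.conj_ofReal (lam n), ← inner_smul_left, h1,
      ← norm_sq_eq_re_inner, h2, one_pow]
  by_contra! hle
  linarith [mul_nonpos_of_nonpos_of_nonneg hle (hpos.re_inner_nonneg_left (u n))]

-- Inversion reverses the order of the positive `lam n`. Beyond N nothing is known of `lam`, so the
-- reciprocal is replaced by 0 there.
open Classical in
theorem IsEigensystem.isSpectralSystem {N : ℕ∞} {lam : ℕ → ℝ} {u : ℕ → W (k + 1)}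
    (h : C.IsEigensystem k N lam u) (hK : C.IsSolutionOperator k K) (hpos : K.IsPositive) :
    IsSpectralSystem (𝕜 := 𝕜) K N (fun n => if (n : ℕ∞) < N then (lam n)⁻¹ else 0) u where
  orthonormal := h.orthonormal
  antitone m n hmn := by
    by_cases hn : (n : ℕ∞) < N
    · have hm : (m : ℕ∞) < N := (Nat.cast_le.2 hmn).trans_lt hn
      simp only [hn, hm, if_true]
      exact inv_anti₀ (h.pos hK hpos hm) (h.monotone m n hmn hn)
    · simp only [hn, if_false]
      split_ifs with hm
      · exact (inv_pos.2 (h.pos hK hpos hm)).le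
      · exact le_rfl
  pos n hn := by
    simp only [hn, if_true]
    exact inv_pos.2 (h.pos hK hpos hn)
  eq_zero n hn := if_neg hn.not_gt
  apply_eq n hn := by
    have h0 : (lam n : 𝕜) ≠ 0 := by exact_mod_cast (h.pos hK hpos hn).ne'
    simp only [hn, if_true]
    rw [RCLike.ofReal_inv, eq_inv_smul_iff₀ h0]
    exact hK.solvesEigenproblem_iff.1 (h.solves n hn)
  mem_span t v ht hv := by
    have h0 : (t : 𝕜) ≠ 0 := by exact_mod_cast ht.ne'
    refine Submodule.span_mono ?_ (h.complete ((t⁻¹ : ℝ) : 𝕜) v (hK.solvesEigenproblem_iff.2 ?_))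
    · rintro _ ⟨n, hn, hnt, rfl⟩
      refine ⟨n, hn, ?_, rfl⟩
      rw [if_pos hn, RCLike.ofReal_inj.1 hnt, inv_inv]
    · rw [hv, RCLike.ofReal_inv, inv_smul_smul₀ h0]

theorem _root_.IsSpectralSystem.isEigensystem {N : ℕ∞} {μ : ℕ → ℝ} {u : ℕ → W (k + 1)}
    (h : IsSpectralSystem (𝕜 := 𝕜) K N μ u) (hK : C.IsSolutionOperator k K)
    (hpos : K.IsPositive) : C.IsEigensystem k N (fun n => (μ n)⁻¹) u where
  orthonormal := h.orthonormal
  monotone _ n hmn hn := inv_anti₀ (h.pos n hn) (h.antitone hmn)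
  solves n hn := by
    have h0 : (μ n : 𝕜) ≠ 0 := by exact_mod_cast (h.pos n hn).ne'
    rw [hK.solvesEigenproblem_iff, h.apply_eq n hn, RCLike.ofReal_inv, inv_smul_smul₀ h0]
  complete t v hv := by
    rw [hK.solvesEigenproblem_iff] at hv
    by_cases hv0 : v = 0
    · rw [hv0]
      exact zero_mem _
    have ht0 : t ≠ 0 := by
      rintro rfl
      exact hv0 (by rw [← hv, zero_smul])
    have hv' : K v = t⁻¹ • v := by rw [eq_inv_smul_iff₀ ht0, hv]
    have hvv : inner 𝕜 v v ≠ 0 := inner_self_ne_zero.2 hv0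
    -- Completeness is required for every t in 𝕜; symmetry of K makes its eigenvalue t⁻¹ real, and
    -- positivity of K then makes it positive.
    have hreal : (starRingEnd 𝕜) t⁻¹ = t⁻¹ := by
      have h1 := hpos.inner_left_eq_inner_right v v
      rw [hv', inner_smul_left, inner_smul_right] at h1
      exact mul_right_cancel₀ hvv h1
    obtain ⟨s, hs⟩ := RCLike.conj_eq_iff_real.1 hreal
    have hspos : 0 < s := by
      have hs0 : s ≠ 0 := by
        rintro rfl
        rw [RCLike.ofReal_zero] at hs
        exact inv_ne_zero ht0 hs
      have h1 := hpos.re_inner_nonneg_left v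
      rw [hv', hs, inner_smul_left, RCLike.conj_ofReal, RCLike.re_ofReal_mul,
        ← norm_sq_eq_re_inner] at h1
      have : 0 < ‖v‖ ^ 2 := by positivity
      exact (nonneg_of_mul_nonneg_left h1 this).lt_of_ne' hs0
    refine Submodule.span_mono ?_ (h.mem_span s v hspos (by rw [hv', hs]))
    rintro _ ⟨n, hn, hns, rfl⟩
    refine ⟨n, hn, ?_, rfl⟩
    rw [hns, RCLike.ofReal_inv, ← hs, inv_inv]

end Eigensystem

/-! ### Norm convergence of the solution operators. -/

namespace IsApproximation

variable {𝕜 : Type*} [RCLike 𝕜]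
    {W : ℤ → Type*} [∀ k, NormedAddCommGroup (W k)] [∀ k, InnerProductSpace 𝕜 (W k)]
    [∀ k, CompleteSpace (W k)] {C : HilbertComplex 𝕜 W} {ι : Type*} {l : Filter ι}
    {Wh : ι → ℤ → Type*} [∀ h k, NormedAddCommGroup (Wh h k)]
    [∀ h k, InnerProductSpace 𝕜 (Wh h k)] [∀ h k, CompleteSpace (Wh h k)]
    {Ch : ∀ h, HilbertComplex 𝕜 (Wh h)} {i : ∀ h, Morphism (Ch h) C}
    {π : ∀ h, Morphism C (Ch h)}

/-- Inserting `J = i* i` between the factors of a product of bounded families of operators does not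
change its limit. -/
theorem tendsto_comp_of_gram (H : IsApproximation C l Ch i π) {a b : ℤ}
    {L : ∀ h, Wh h b →L[𝕜] Wh h a} {M : ∀ h, Wh h a →L[𝕜] Wh h b} {c : ℝ} (hL : ∀ h, ‖L h‖ ≤ c)
    (hM : ∀ h, ‖M h‖ ≤ c) (hc : 0 ≤ c) {A : W a →L[𝕜] W a}
    (hA : Tendsto (fun h => ((i h).toMap a ∘L L h ∘L adjoint ((i h).toMap b))
      ∘L ((i h).toMap b ∘L M h ∘L adjoint ((i h).toMap a))) l (𝓝 A)) :
    Tendsto (fun h => (i h).toMap a ∘L (L h ∘L M h) ∘L adjoint ((i h).toMap a)) l (𝓝 A) := by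
  obtain ⟨c', hc', hi, -⟩ := H.exists_bound a
  refine hA.congr_dist ?_
  have h0 := (H.gram b).const_mul (c' * c * c * c')
  rw [mul_zero] at h0
  refine squeeze_zero (fun _ => dist_nonneg) (fun h => ?_) h0
  rw [dist_comm, dist_eq_norm]
  refine ContinuousLinearMap.opNorm_le_bound _ (by positivity) fun x => ?_
  set D := ContinuousLinearMap.id 𝕜 (Wh h b) - adjoint ((i h).toMap b) ∘L (i h).toMap b with hD
  have e : ((i h).toMap a ∘L (L h ∘L M h) ∘L adjoint ((i h).toMap a)
      - ((i h).toMap a ∘L L h ∘L adjoint ((i h).toMap b))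
        ∘L ((i h).toMap b ∘L M h ∘L adjoint ((i h).toMap a))) x
      = (i h).toMap a (L h (D (M h (adjoint ((i h).toMap a) x)))) := by
    simp [hD]
  rw [e]
  have hadj : ‖adjoint ((i h).toMap a)‖ ≤ c' := by
    rw [LinearIsometryEquiv.norm_map]
    exact hi h
  refine (((i h).toMap a).le_of_opNorm_le_of_le (hi h) ((L h).le_of_opNorm_le_of_le (hL h)
    (D.le_opNorm_of_le ((M h).le_of_opNorm_le_of_le (hM h)
      (ContinuousLinearMap.le_of_opNorm_le _ hadj x))))).trans_eq ?_
  ring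

variable {k : ℤ} {T : W (k + 1) →L[𝕜] W k} {Th : ∀ h, Wh h (k + 1) →L[𝕜] Wh h k}
  {S : W (k + 1 + 1) →L[𝕜] W (k + 1)} {Sh : ∀ h, Wh h (k + 1 + 1) →L[𝕜] Wh h (k + 1)}

/-- The adjoint is norm continuous, so each factor of T*T + SS* converges after embedding. Between
the embedded factors stands i* i, which is removed at no cost in the limit. -/
theorem tendsto_solutionOperator (H : IsApproximation C l Ch i π)
    (hT : C.IsPartialInverse k T) (hTh : ∀ h, (Ch h).IsPartialInverse k (Th h))
    (hS : C.IsPartialInverse (k + 1) S) (hSh : ∀ h, (Ch h).IsPartialInverse (k + 1) (Sh h)) :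
    Tendsto (fun h => (i h).toMap (k + 1) ∘L (adjoint (Th h) ∘L Th h + Sh h ∘L adjoint (Sh h))
      ∘L adjoint ((i h).toMap (k + 1))) l (𝓝 (adjoint T ∘L T + S ∘L adjoint S)) := by
  obtain ⟨c, hc, hTc⟩ := H.exists_bound_partialInverse hT hTh
  obtain ⟨c', hc', hSc⟩ := H.exists_bound_partialInverse hS hSh
  have hTl := H.tendsto_partialInverse hT hTh
  have hSl := H.tendsto_partialInverse hS hSh
  have hTl' : Tendsto (fun h => adjoint ((i h).toMap k ∘L Th h ∘L adjoint ((i h).toMap (k + 1))))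
      l (𝓝 (adjoint T)) := (adjoint.continuous.tendsto T).comp hTl
  have hSl' : Tendsto (fun h => adjoint ((i h).toMap (k + 1) ∘L Sh h
      ∘L adjoint ((i h).toMap (k + 1 + 1)))) l (𝓝 (adjoint S)) :=
    (adjoint.continuous.tendsto S).comp hSl
  have h1 := H.tendsto_comp_of_gram (L := fun h => adjoint (Th h)) (M := Th) (c := c)
    (fun h => by rw [LinearIsometryEquiv.norm_map]; exact hTc h) hTc hc
    ((hTl'.clm_comp hTl).congr fun h => by
      simp only [ContinuousLinearMap.adjoint_comp, ContinuousLinearMap.adjoint_adjoint,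
        ContinuousLinearMap.comp_assoc])
  have h2 := H.tendsto_comp_of_gram (L := Sh) (M := fun h => adjoint (Sh h)) (c := c')
    hSc (fun h => by rw [LinearIsometryEquiv.norm_map]; exact hSc h) hc'
    ((hSl.clm_comp hSl').congr fun h => by
      simp only [ContinuousLinearMap.adjoint_comp, ContinuousLinearMap.adjoint_adjoint,
        ContinuousLinearMap.comp_assoc])
  refine (h1.add h2).congr fun h => ?_
  rw [ContinuousLinearMap.add_comp, ContinuousLinearMap.comp_add]

theorem exists_resolventsConverge (H : IsApproximation C l Ch i π)
    (hT : C.IsPartialInverse k T) (hTh : ∀ h, (Ch h).IsPartialInverse k (Th h))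
    (hS : C.IsPartialInverse (k + 1) S) (hSh : ∀ h, (Ch h).IsPartialInverse (k + 1) (Sh h)) :
    ∃ c, ResolventsConverge l (fun h => (i h).toMap (k + 1)) (adjoint T ∘L T + S ∘L adjoint S)
      (fun h => adjoint (Th h) ∘L Th h + Sh h ∘L adjoint (Sh h)) c := by
  obtain ⟨c, hc, hTc⟩ := H.exists_bound_partialInverse hT hTh
  obtain ⟨c', hc', hSc⟩ := H.exists_bound_partialInverse hS hSh
  obtain ⟨a, ha, hi, hπ⟩ := H.exists_bound (k + 1)
  have hle : a ≤ a + (c * c + c' * c') := le_add_of_nonneg_right (by positivity)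
  exact ⟨a + (c * c + c' * c'),
    { compact := isCompactOperator_adjoint_comp_add
        (hT.isCompactOperator (H.closed k) H.compactness)
        (hS.isCompactOperator (H.closed (k + 1)) H.compactness)
      positive := isPositive_adjoint_comp_add T S
      compact_discrete := fun h => isCompactOperator_adjoint_comp_add
        (H.isCompactOperator_partialInverse hT hTh h) (H.isCompactOperator_partialInverse hS hSh h)
      positive_discrete := fun h => isPositive_adjoint_comp_add (Th h) (Sh h)
      nonneg := by positivity
      norm_embed_le := fun h => (hi h).trans hle
      norm_le_mul := fun h y => by
        have := ((π h).toMap (k + 1)).le_of_opNorm_le ((hπ h).trans hle) ((i h).toMap (k + 1) y)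
        rwa [H.retraction] at this
      norm_discrete_le := fun h =>
        (norm_adjoint_comp_add_le (hTc h) (hSc h)).trans (le_add_of_nonneg_left ha)
      tendsto_gram := H.gram (k + 1)
      tendsto_norm := by
        refine (tendsto_iff_norm_sub_tendsto_zero.1
          (H.tendsto_solutionOperator hT hTh hS hSh)).congr fun h => ?_
        exact norm_sub_rev _ _
      tendsto_apply := H.tendsto_embed_adjoint (k + 1) }⟩

end IsApproximation

end HilbertComplex

theorem ResolventsConverge.tendsto_pulledBackProjection {𝕜 ι E : Type*} [RCLike 𝕜] {l : Filter ι}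
    [NormedAddCommGroup E] [InnerProductSpace 𝕜 E] [CompleteSpace E]
    {F : ι → Type*} [∀ h, NormedAddCommGroup (F h)] [∀ h, InnerProductSpace 𝕜 (F h)]
    [∀ h, CompleteSpace (F h)] {i : ∀ h, F h →L[𝕜] E}
    {K : E →L[𝕜] E} {Kh : ∀ h, F h →L[𝕜] F h} {c : ℝ} (H : ResolventsConverge l i K Kh c)
    {π : ∀ h, E →L[𝕜] F h} (hπi : ∀ h w, π h (i h w) = w) {c' : ℝ} (hπ : ∀ h, ‖π h‖ ≤ c') :
    Tendsto (fun h => ‖K - i h ∘L Kh h ∘L pulledBackProjection (i h) (π h)‖) l (𝓝 0) := by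
  have hc := H.nonneg
  have h0 := H.tendsto_norm.add ((H.tendsto_gram.mul_const c').const_mul (c * c))
  simp only [zero_mul, mul_zero, add_zero] at h0
  refine squeeze_zero (fun _ => norm_nonneg _) (fun h => ?_) h0
  have e : K - i h ∘L Kh h ∘L pulledBackProjection (i h) (π h)
      = (K - i h ∘L Kh h ∘L adjoint (i h))
        - (i h ∘L Kh h) ∘L (pulledBackProjection (i h) (π h) - adjoint (i h)) := by
    ext x
    simp
  rw [e]
  refine (norm_sub_le _ _).trans (add_le_add_right ?_ _)
  refine (ContinuousLinearMap.opNorm_comp_le _ _).trans ?_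
  refine mul_le_mul ?_ ?_ (norm_nonneg _) (by positivity)
  · exact (ContinuousLinearMap.opNorm_comp_le _ _).trans
      (mul_le_mul (H.norm_embed_le h) (H.norm_discrete_le h) (norm_nonneg _) hc)
  · exact (norm_sub_comp_pulledBackProjection_le (i h) (π h) (hπi h)).trans
      (mul_le_mul_of_nonneg_left (hπ h) (norm_nonneg _))

/-- The spectral convergence of the solution operators after taking reciprocals. For n ≥ N the limit
of the discrete values is 0, which is divergence to infinity for the discrete eigenvalues. -/
theorem ResolventsConverge.eigenproblemsConverge {𝕜 ι : Type*} [RCLike 𝕜] {l : Filter ι}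
    {W : ℤ → Type*} [∀ k, NormedAddCommGroup (W k)] [∀ k, InnerProductSpace 𝕜 (W k)]
    [∀ k, CompleteSpace (W k)] {C : HilbertComplex 𝕜 W}
    {Wh : ι → ℤ → Type*} [∀ h k, NormedAddCommGroup (Wh h k)]
    [∀ h k, InnerProductSpace 𝕜 (Wh h k)] [∀ h k, CompleteSpace (Wh h k)]
    {Ch : ∀ h, HilbertComplex 𝕜 (Wh h)} {k : ℤ} {i : ∀ h, Wh h (k + 1) →L[𝕜] W (k + 1)}
    {K : W (k + 1) →L[𝕜] W (k + 1)} {Kh : ∀ h, Wh h (k + 1) →L[𝕜] Wh h (k + 1)} {c : ℝ}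
    (H : ResolventsConverge l i K Kh c) (hK : C.IsSolutionOperator k K)
    (hKh : ∀ h, (Ch h).IsSolutionOperator k (Kh h)) {N : ℕ∞} {lam : ℕ → ℝ} {u : ℕ → W (k + 1)}
    {Nh : ι → ℕ∞} {lamh : ι → ℕ → ℝ} {uh : ∀ h, ℕ → Wh h (k + 1)}
    (hu : C.IsEigensystem k N lam u)
    (huh : ∀ h, (Ch h).IsEigensystem k (Nh h) (lamh h) (uh h)) :
    EigenproblemsConverge (𝕜 := 𝕜) l i N lam u Nh lamh uh := by
  classical
  have hμ := hu.isSpectralSystem hK H.positive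
  have hμh := fun h => (huh h).isSpectralSystem (hKh h) (H.positive_discrete h)
  have hev : ∀ n : ℕ, (n : ℕ∞) < N → ∀ᶠ h in l, (n : ℕ∞) < Nh h := fun n hn => by
    have hle : ((n + 1 : ℕ) : ℕ∞) ≤ N := by exact_mod_cast Order.add_one_le_of_lt hn
    filter_upwards [H.eventually_le_card hμ hμh hle] with h hh
    exact (Nat.cast_lt.2 (Nat.lt_succ_self n)).trans_le hh
  refine ⟨hev, fun n hn => ?_, fun n hn M => ?_, fun m hm hgap => ?_⟩
  · have h1 := H.tendsto_eigenvalue hμ hμh n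
    rw [if_pos hn] at h1
    have h2 := h1.inv₀ (inv_ne_zero (hu.pos hK H.positive hn).ne')
    rw [inv_inv] at h2
    refine h2.congr' ?_
    filter_upwards [hev n hn] with h hh
    rw [if_pos hh, inv_inv]
  · have h1 := H.tendsto_eigenvalue hμ hμh n
    rw [if_neg hn.not_gt] at h1
    have hM : 0 < (|M| + 1)⁻¹ := by positivity
    filter_upwards [h1.eventually_lt_const hM] with h hh hnh
    rw [if_pos hnh] at hh
    have h2 := (inv_lt_inv₀ ((huh h).pos (hKh h) (H.positive_discrete h) hnh) (by positivity)).1 hh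
    linarith [le_abs_self M]
  · refine H.tendsto_gap hμ hμh hm fun a ha => ?_
    have haN : (a : ℕ∞) < N := (Nat.cast_lt.2 ha).trans_le hm
    have hapos := hu.pos hK H.positive haN
    rw [if_pos haN]
    -- For m = N the comparison value is the default 0, below every positive eigenvalue of K.
    split_ifs with hmN
    · exact (inv_lt_inv₀ (hu.pos hK H.positive hmN) hapos).2 (hgap a m ha le_rfl hmN)
    · exact inv_pos.2 hapos

theorem mainTheorem7 {𝕜 : Type*} [RCLike 𝕜]
    {W : ℤ → Type*} [∀ k, NormedAddCommGroup (W k)] [∀ k, InnerProductSpace 𝕜 (W k)]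
    [∀ k, CompleteSpace (W k)]
    (C : HilbertComplex 𝕜 W) (hC : C.IsClosedComplex) (hcompact : C.CompactnessProperty)
    {ι : Type*} (l : Filter ι)
    {Wh : ι → ℤ → Type*} [∀ h k, NormedAddCommGroup (Wh h k)]
    [∀ h k, InnerProductSpace 𝕜 (Wh h k)] [∀ h k, CompleteSpace (Wh h k)]
    (Ch : ∀ h, HilbertComplex 𝕜 (Wh h)) (hCh : ∀ h, (Ch h).IsClosedComplex)
    (i : ∀ h, HilbertComplex.Morphism (Ch h) C) (π : ∀ h, HilbertComplex.Morphism C (Ch h))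
    (hπi : ∀ h k (w : Wh h k), (π h).toMap k ((i h).toMap k w) = w)
    (hi_bdd : ∀ k, ∃ c : ℝ, ∀ h, ‖(i h).toMap k‖ ≤ c)
    (hπ_bdd : ∀ k, ∃ c : ℝ, ∀ h, ‖(π h).toMap k‖ ≤ c)
    (happrox : ∀ k, ∀ v ∈ (C.d k).domain, Tendsto
      (fun h => Metric.infDist v ((i h).toMap k '' ((Ch h).d k).domain)) l (𝓝 0))
    (hJ : ∀ k, Tendsto (fun h => ‖ContinuousLinearMap.id 𝕜 (Wh h k)
      - (ContinuousLinearMap.adjoint ((i h).toMap k)) ∘L ((i h).toMap k)‖) l (𝓝 0))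
    (k : ℤ) :
    -- the solution operators exist and converge in the operator norm
    (∃ (K : W (k + 1) →L[𝕜] W (k + 1)) (Kh : ∀ h, Wh h (k + 1) →L[𝕜] Wh h (k + 1)),
      C.IsSolutionOperator k K ∧ (∀ h, (Ch h).IsSolutionOperator k (Kh h)) ∧
      Tendsto (fun h => ‖K - (i h).toMap (k + 1) ∘L Kh h ∘L
        pulledBackProjection ((i h).toMap (k + 1)) ((π h).toMap (k + 1))‖) l (𝓝 0)) ∧
    -- the exact and the discrete eigenvalue problems have complete systems of eigenvectors
    (∃ N lam u, C.IsEigensystem k N lam u) ∧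
    (∀ h, ∃ N lam u, (Ch h).IsEigensystem k N lam u) ∧
    -- whichever such systems are chosen, the discrete ones converge to the exact one
    (∀ N lam u Nh lamh uh, C.IsEigensystem k N lam u →
      (∀ h, (Ch h).IsEigensystem k (Nh h) (lamh h) (uh h)) →
      EigenproblemsConverge (𝕜 := 𝕜) l (fun h => (i h).toMap (k + 1)) N lam u Nh lamh uh) := by
  have H : HilbertComplex.IsApproximation C l Ch i π :=
    ⟨hC, hCh, hcompact, hπi, hi_bdd, hπ_bdd, happrox, hJ⟩
  obtain ⟨T, hT⟩ := HilbertComplex.exists_isPartialInverse (hC k)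
  obtain ⟨S, hS⟩ := HilbertComplex.exists_isPartialInverse (hC (k + 1))
  choose Th hTh using fun h => HilbertComplex.exists_isPartialInverse (hCh h k)
  choose Sh hSh using fun h => HilbertComplex.exists_isPartialInverse (hCh h (k + 1))
  have hK := hT.isSolutionOperator hC hS
  have hKh := fun h => (hTh h).isSolutionOperator (hCh h) (hSh h)
  obtain ⟨c, hconv⟩ := H.exists_resolventsConverge hT hTh hS hSh
  obtain ⟨c', hπ'⟩ := hπ_bdd (k + 1)
  refine ⟨⟨_, _, hK, hKh, hconv.tendsto_pulledBackProjection (fun h => hπi h (k + 1)) hπ'⟩,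
    ?_, fun h => ?_, fun N lam u Nh lamh uh hu huh => hconv.eigenproblemsConverge hK hKh hu huh⟩
  · obtain ⟨N, μ, u, hu⟩ := exists_isSpectralSystem hconv.compact hconv.positive
    exact ⟨N, _, u, hu.isEigensystem hK hconv.positive⟩
  · obtain ⟨N, μ, u, hu⟩ :=
      exists_isSpectralSystem (hconv.compact_discrete h) (hconv.positive_discrete h)
    exact ⟨N, _, u, hu.isEigensystem (hKh h) (hconv.positive_discrete h)⟩
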